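/- Let $n\ge 2$. A flat virtual $n$-tangle is a partition of $\{0,1\}\times\{1,\dots,n\}$ into pairs. Let $\mathrm{VTL}_n$ be the free $\mathbb Z[z]$-module with basis the set of flat virtual $n$-tangles, with the bilinear multiplication defined on basis elements by $E\,E'=z^m\,(E*E')$: concatenate the diagrams of $E$ and $E'$ by identifying each point $(1,k)$ of $E$ with the point $(0,k)$ of $E'$; then $E*E'$ is the flat virtual $n$-tangle formed by the endpoints of the resulting $n$ arcs, and $m$ is the number of resulting closed curves. This is a unital associative $\mathbb Z[z]$-algebra, with unit the tangle $\{\{(0,k),(1,k)\} : 1\le k\le n\}$. For $1\le i\le n-1$ let $E_i$ be the tangle with pairs $\{(0,i),(0,i+1)\}$, $\{(1,i),(1,i+1)\}$ and $\{(0,k),(1,k)\}$ for $k\ne i,i+1$, and let $v_i$ be the tangle with pairs $\{(0,i),(1,i+1)\}$, $\{(0,i+1),(1,i)\}$ and $\{(0,k),(1,k)\}$ for $k\neq i,i+1$. Then $\mathrm{VTL}_n$ has, as a unital associative $\mathbb Z[z]$-algebra, a presentation with generators $E_1,\dots,E_{n-1},v_1,\dots,v_{n-1}$ and relations \begin{gather*}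 E_i^2=zE_i,\quad v_i^2=1,\quad E_iv_i=v_iE_i=E_i\qquad\text{for } 1\le i\le n-1,\\ E_iE_j=E_jE_i,\quad v_iv_j=v_jv_i,\quad v_iE_j=E_jv_i\qquad\text{for } |i-j|\ge 2,\\ E_iv_jE_i=E_i,\quad v_iv_jv_i=v_jv_iv_j,\quad v_iv_jE_i=E_jv_iv_j\qquad\text{for } |i-j|=1. \end{gather*} That is, the algebra defined by this presentation is isomorphic to $\mathrm{VTL}_n$ by the isomorphism that sends each generator to the tangle of the same name. -/

import Mathlib

open Polynomial

noncomputable section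

namespace VirtualTL

/-- A flat virtual `n`-tangle: a partition of `{0, 1} × {1, …, n}` into pairs, given as the
equivalence relation whose classes are the blocks; every point has exactly one partner. -/
@[ext]
structure FlatTangle (n : ℕ) where
  rel : Setoid (Fin 2 × Fin n)
  pair : ∀ x, ∃! y, y ≠ x ∧ rel x y

/-- The map on points induced by a map on rows. -/
def rows {k l n : ℕ} (e : Fin k → Fin l) (p : Fin k × Fin n) : Fin l × Fin n := (e p.1, p.2)

/-- The concatenation of the diagrams of `E` and `E'`: there are three rows of points, `E` joins
points of the rows `0, 1` and `E'` joins points of the rows `1, 2`. Two points are related if they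
lie on the same curve of the concatenated diagram. -/
def stack {n : ℕ} (E E' : FlatTangle n) : Setoid (Fin 3 × Fin n) :=
  E.rel.map (rows ![0, 1]) ⊔ E'.rel.map (rows ![1, 2])

/-- The number of closed curves in the concatenation of `E` and `E'`, that is, of curves
all of whose points are in the middle row. -/
def loops {n : ℕ} (E E' : FlatTangle n) : ℕ :=
  {C | C ∈ (stack E E').classes ∧ ∀ p ∈ C, p.1 = 1}.ncard

/-! ### Auxiliary facts: the arcs of a concatenation pair off the outer points -/

theorem map_le_iff {α β : Type*} (r : Setoid α) (f : α → β) (t : Setoid β) :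
    r.map f ≤ t ↔ r ≤ t.comap f := by
  constructor
  · intro h x y hxy
    exact h (Relation.EqvGen.rel _ _ ⟨x, y, hxy, rfl, rfl⟩)
  · intro h
    apply Setoid.eqvGen_le
    rintro _ _ ⟨x, y, hxy, rfl, rfl⟩
    exact h hxy

theorem map_rel {α β : Type*} (r : Setoid α) (f : α → β) {x y : α} (h : r x y) :
    r.map f (f x) (f y) := Relation.EqvGen.rel _ _ ⟨x, y, h, rfl, rfl⟩

theorem map_iff {α β : Type*} (r : Setoid α) {f : α → β} (hf : Function.Injective f) (x y : β) :
    r.map f x y ↔ x = y ∨ ∃ p q, r p q ∧ f p = x ∧ f q = y := by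
  constructor
  · intro h
    let t : Setoid β :=
      { r := fun x y => x = y ∨ ∃ p q, r p q ∧ f p = x ∧ f q = y
        iseqv :=
          { refl := fun x => Or.inl rfl
            symm := by
              rintro x y (h | ⟨p, q, h, h1, h2⟩)
              · exact Or.inl h.symm
              · exact Or.inr ⟨q, p, r.symm h, h2, h1⟩
            trans := by
              rintro x y z (rfl | ⟨p, q, h, h1, h2⟩) h'
              · exact h'
              · rcases h' with rfl | ⟨p', q', h', h1', h2'⟩
                · exact Or.inr ⟨p, q, h, h1, h2⟩
                · have : q = p' := hf (h2.trans h1'.symm)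
                  subst this
                  exact Or.inr ⟨p, q', r.trans h h', h1, h2'⟩ } }
    have : r.map f ≤ t := (map_le_iff _ _ _).2 fun p q h => Or.inr ⟨p, q, h, rfl, rfl⟩
    exact this h
  · rintro (rfl | ⟨p, q, h, rfl, rfl⟩)
    · exact Setoid.refl' _ _
    · exact map_rel r f h

theorem map_sup {α β : Type*} (r s : Setoid α) (f : α → β) :
    (r ⊔ s).map f = r.map f ⊔ s.map f := by
  apply le_antisymm
  · rw [map_le_iff]
    exact sup_le ((map_le_iff _ _ _).1 le_sup_left) ((map_le_iff _ _ _).1 le_sup_right)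
  · exact sup_le ((map_le_iff _ _ _).2 (le_sup_left.trans ((map_le_iff _ _ _).1 le_rfl)))
      ((map_le_iff _ _ _).2 (le_sup_right.trans ((map_le_iff _ _ _).1 le_rfl)))

theorem map_map {α β γ : Type*} (r : Setoid α) (f : α → β) (g : β → γ) :
    (r.map f).map g = r.map (g ∘ f) := by
  apply eq_of_forall_ge_iff
  intro t
  rw [map_le_iff, map_le_iff, map_le_iff]
  rfl

theorem rows_comp {k l m n : ℕ} (e : Fin k → Fin l) (f : Fin l → Fin m) :
    (rows f ∘ rows e : Fin k × Fin n → _) = rows (f ∘ e) := rfl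

theorem rows_injective {k l n : ℕ} {e : Fin k → Fin l} (he : Function.Injective e) :
    Function.Injective (rows e : Fin k × Fin n → _) := by
  rintro ⟨a, b⟩ ⟨c, d⟩ h
  simp only [rows, Prod.mk.injEq] at h
  rw [he h.1, h.2]

/-- If `a`, `b` are involutions, `a` without fixed points, then any fixed point of `b` shares its
orbit under the group generated by `a` and `b` with exactly one other fixed point of `b`. -/
theorem existsUnique_other_end {W : Type*} [Finite W] (a b : Equiv.Perm W)
    (ha : ∀ w, a (a w) = w) (hb : ∀ w, b (b w) = w) (hfix : ∀ w, a w ≠ w) (x : W) (hx : b x = x) :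
    ∃! y, y ≠ x ∧ b y = y ∧ ∃ k : ℤ, ((b * a) ^ k) x = y := by
  have ha' : a⁻¹ = a := inv_eq_of_mul_eq_one_left (Equiv.ext ha)
  have hb' : b⁻¹ = b := inv_eq_of_mul_eq_one_left (Equiv.ext hb)
  have hbb : b * b = 1 := Equiv.ext hb
  have hcinv : (b * a)⁻¹ = a * b := by rw [mul_inv_rev, ha', hb']
  have hconj : ∀ k : ℤ, b * (b * a) ^ k = (b * a) ^ (-k) * b := by
    intro k
    have h1 : b * (b * a) * b⁻¹ = (b * a)⁻¹ := by
      rw [hcinv, hb', ← mul_assoc, hbb, one_mul]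
    have h2 := conj_zpow (i := k) (a := b) (b := b * a)
    rw [h1, inv_zpow', hb'] at h2
    rw [h2, mul_assoc, hbb, mul_one]
  have hbk : ∀ k : ℤ, b (((b * a) ^ k) x) = ((b * a) ^ (-k)) x := by
    intro k
    have := congrArg (fun g : Equiv.Perm W => g x) (hconj k)
    simpa [Equiv.Perm.mul_apply, hx] using this
  have hak : ∀ k : ℤ, a (((b * a) ^ k) x) = ((b * a) ^ (-k - 1)) x := by
    intro k
    have h1 : b (a (((b * a) ^ k) x)) = ((b * a) ^ (k + 1)) x := by
      rw [add_comm, zpow_add, zpow_one]; rfl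
    have h2 := hbk (k + 1)
    rw [← h1, hb] at h2
    rw [h2]; congr 2; ring
  set c := b * a with hc
  set p := Function.minimalPeriod (c • ·) x with hp
  have hper : ∀ k : ℤ, (c ^ k) x = x ↔ (p : ℤ) ∣ k := fun k =>
    MulAction.zpow_smul_eq_iff_minimalPeriod_dvd (a := c) (b := x) (n := k)
  have hper2 : ∀ k l : ℤ, (c ^ k) x = (c ^ l) x ↔ (p : ℤ) ∣ k - l := fun k l => by
    rw [← hper, sub_eq_neg_add, zpow_add, Equiv.Perm.mul_apply, zpow_neg,
      Equiv.Perm.inv_eq_iff_eq]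
  have hppos : 0 < p := by
    refine Function.minimalPeriod_pos_of_mem_periodicPts ?_
    exact (Function.Injective.mem_periodicPts (MulAction.injective c)) x
  have hodd : ∀ k : ℤ, ¬ (p : ℤ) ∣ 2 * k + 1 := by
    intro k hk
    apply hfix ((c ^ k) x)
    rw [hak, hper2]
    rw [show -k - 1 - k = -(2 * k + 1) by ring]
    exact hk.neg_right
  have heven : Even p := by
    by_contra h
    obtain ⟨m, hm⟩ := Nat.not_even_iff_odd.1 h
    exact hodd m (by rw [hm]; push_cast; exact dvd_rfl)
  obtain ⟨m, hm⟩ := heven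
  have hfixk : ∀ k : ℤ, b ((c ^ k) x) = (c ^ k) x ↔ (p : ℤ) ∣ 2 * k := by
    intro k
    rw [hbk, hper2, show -k - k = -(2 * k) by ring, dvd_neg]
  refine ⟨(c ^ (m : ℤ)) x, ⟨?_, ?_, m, rfl⟩, ?_⟩
  · rw [Ne, hper, hm]
    intro h
    have := Int.le_of_dvd (by omega) h
    omega
  · rw [hfixk, hm]
    exact ⟨1, by push_cast; ring⟩
  · rintro _ ⟨h1, h2, k, rfl⟩
    rw [hfixk] at h2
    rw [Ne, hper] at h1
    rw [hper2]
    obtain ⟨q, hq⟩ := h2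
    have hk : k = m * q := by rw [hm] at hq; push_cast at hq; linarith
    rcases Int.even_or_odd q with ⟨u, hu⟩ | ⟨u, hu⟩
    · exact absurd ⟨u, by rw [hk, hu, hm]; push_cast; ring⟩ h1
    · exact ⟨u, by rw [hk, hu, hm]; push_cast; ring⟩

/-- The partner of a point. -/
def FlatTangle.partner {n : ℕ} (E : FlatTangle n) (x : Fin 2 × Fin n) : Fin 2 × Fin n :=
  (E.pair x).choose

theorem FlatTangle.partner_ne {n : ℕ} (E : FlatTangle n) (x) : E.partner x ≠ x :=
  (E.pair x).choose_spec.1.1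

theorem FlatTangle.rel_partner {n : ℕ} (E : FlatTangle n) (x) : E.rel x (E.partner x) :=
  (E.pair x).choose_spec.1.2

theorem FlatTangle.eq_partner {n : ℕ} (E : FlatTangle n) {x y} (h : y ≠ x) (h' : E.rel x y) :
    y = E.partner x :=
  (E.pair x).choose_spec.2 y ⟨h, h'⟩

theorem FlatTangle.partner_partner {n : ℕ} (E : FlatTangle n) (x) :
    E.partner (E.partner x) = x :=
  (E.eq_partner (E.partner_ne x).symm (E.rel.symm (E.rel_partner x))).symm

/-- The involution on two disjoint copies of the points given by the partners in `E` and `E'`. -/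
def arcs {n : ℕ} (E E' : FlatTangle n) : Equiv.Perm (Fin 2 × (Fin 2 × Fin n)) :=
  Function.Involutive.toPerm
    (fun w => (w.1, if w.1 = 0 then E.partner w.2 else E'.partner w.2)) (by
      rintro ⟨k, x⟩
      by_cases h : k = 0 <;> simp [h, FlatTangle.partner_partner])

theorem arcs_apply {n : ℕ} (E E' : FlatTangle n) (w) : arcs E E' w =
    (w.1, if w.1 = 0 then E.partner w.2 else E'.partner w.2) := rfl

/-- The gluing of row `1` of the first copy with row `0` of the second. -/
def glue (n : ℕ) : Equiv.Perm (Fin 2 × (Fin 2 × Fin n)) :=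
  Function.Involutive.toPerm
    (fun w => if w.1 = w.2.1 then w else (w.2.1, (w.1, w.2.2))) (by
      rintro ⟨k, r, i⟩
      by_cases h : k = r
      · simp [h]
      · simp [h, Ne.symm h])

theorem glue_apply {n : ℕ} (w : Fin 2 × (Fin 2 × Fin n)) : glue n w =
    if w.1 = w.2.1 then w else (w.2.1, (w.1, w.2.2)) := rfl

/-- The point of the concatenation represented by a point in one of the two copies. -/
def proj {n : ℕ} (w : Fin 2 × (Fin 2 × Fin n)) : Fin 3 × Fin n :=
  if w.1 = 0 then rows ![0, 1] w.2 else rows ![1, 2] w.2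

theorem proj_glue {n : ℕ} (w : Fin 2 × (Fin 2 × Fin n)) : proj (glue n w) = proj w := by
  obtain ⟨k, r, i⟩ := w
  fin_cases k <;> fin_cases r <;>
    simp [proj, glue_apply, rows]

theorem eq_of_proj_eq {n : ℕ} {w w' : Fin 2 × (Fin 2 × Fin n)} (h : proj w = proj w') :
    w' = w ∨ w' = glue n w := by
  obtain ⟨k, r, i⟩ := w
  obtain ⟨k', r', i'⟩ := w'
  fin_cases k <;> fin_cases r <;> fin_cases k' <;> fin_cases r' <;>
    simp [proj, glue_apply, rows] at h ⊢ <;> exact h.symm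

theorem stack_proj_arcs {n : ℕ} (E E' : FlatTangle n) (w) :
    stack E E' (proj w) (proj (arcs E E' w)) := by
  obtain ⟨k, x⟩ := w
  by_cases h : k = 0
  · simp only [proj, arcs_apply, h, if_true]
    exact (le_sup_left : _ ≤ stack E E') (map_rel _ _ (E.rel_partner x))
  · simp only [proj, arcs_apply, h, if_false]
    exact (le_sup_right : _ ≤ stack E E') (map_rel _ _ (E'.rel_partner x))

/-- The curve through `proj w` consists of the points met by following arcs from `w`. -/
theorem stack_iff {n : ℕ} (E E' : FlatTangle n) (w : Fin 2 × (Fin 2 × Fin n))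
    (hw : glue n w = w) (y : Fin 3 × Fin n) :
    stack E E' (proj w) y ↔ ∃ k : ℤ, proj (((glue n * arcs E E') ^ k) w) = y := by
  have hga : ∀ w, arcs E E' (arcs E E' w) = w := fun w =>
    Function.Involutive.toPerm_involutive _ w
  have hgb : ∀ w, glue n (glue n w) = w := fun w =>
    Function.Involutive.toPerm_involutive _ w
  have hb' : (glue n)⁻¹ = glue n := inv_eq_of_mul_eq_one_left (Equiv.ext hgb)
  have ha' : (arcs E E')⁻¹ = arcs E E' := inv_eq_of_mul_eq_one_left (Equiv.ext hga)
  set c := glue n * arcs E E' with hc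
  constructor
  · -- the orbit is closed under gluing and arcs
    have hbO : ∀ k : ℤ, glue n ((c ^ k) w) = (c ^ (-k)) w := by
      intro k
      have h1 : glue n * c * (glue n)⁻¹ = c⁻¹ := by
        rw [hc, mul_inv_rev, ha', hb', ← mul_assoc,
          show glue n * glue n = 1 from Equiv.ext hgb, one_mul]
      have h2 := conj_zpow (i := k) (a := glue n) (b := c)
      rw [h1, inv_zpow'] at h2
      rw [h2, Equiv.Perm.mul_apply, Equiv.Perm.mul_apply, hb', hw]
    have haO : ∀ k : ℤ, ∃ l : ℤ, arcs E E' ((c ^ k) w) = (c ^ l) w := by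
      intro k
      refine ⟨-(k + 1), ?_⟩
      rw [← hbO, add_comm, zpow_add, zpow_one]
      exact (hgb _).symm
    let P : Fin 3 × Fin n → Prop := fun y => ∃ k : ℤ, proj ((c ^ k) w) = y
    have hP : ∀ u, P (proj u) → ∃ k : ℤ, (c ^ k) w = u := by
      rintro u ⟨k, hk⟩
      rcases eq_of_proj_eq hk with h | h
      · exact ⟨k, h.symm⟩
      · exact ⟨-k, by rw [h, hbO]⟩
    have key : ∀ u, P (proj u) → P (proj (arcs E E' u)) := by
      intro u hu
      obtain ⟨k, rfl⟩ := hP u hu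
      obtain ⟨l, hl⟩ := haO k
      exact ⟨l, by rw [hl]⟩
    let t : Setoid (Fin 3 × Fin n) := Setoid.ker P
    have hEt : ∀ u, t (proj u) (proj (arcs E E' u)) := fun u => by
      refine propext ⟨key u, fun h => ?_⟩
      have := key _ h
      rwa [hga] at this
    have hle : stack E E' ≤ t := by
      refine sup_le ((map_le_iff _ _ _).2 ?_) ((map_le_iff _ _ _).2 ?_)
      · intro x y hxy
        by_cases hne : y = x
        · subst hne; exact Setoid.refl' _ _
        · rw [E.eq_partner hne hxy]
          simpa [proj, arcs_apply] using hEt (0, x)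
      · intro x y hxy
        by_cases hne : y = x
        · subst hne; exact Setoid.refl' _ _
        · rw [E'.eq_partner hne hxy]
          simpa [proj, arcs_apply] using hEt (1, x)
    intro h
    have h2 : P (proj w) = P y := hle h
    exact h2.mp ⟨0, by simp⟩
  · rintro ⟨k, rfl⟩
    have step : ∀ u, stack E E' (proj u) (proj (c u)) := fun u => by
      rw [hc, Equiv.Perm.mul_apply, proj_glue]
      exact stack_proj_arcs E E' u
    have : ∀ k : ℤ, stack E E' (proj w) (proj ((c ^ k) w)) := by
      intro k
      induction k using Int.induction_on with
      | zero => simp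
      | succ i ih =>
        refine Setoid.trans' _ ih ?_
        rw [add_comm, zpow_add, zpow_one, Equiv.Perm.mul_apply]
        exact step _
      | pred i ih =>
        refine Setoid.trans' _ ih (Setoid.symm' _ ?_)
        have := step ((c ^ (-(i : ℤ) - 1)) w)
        rwa [← Equiv.Perm.mul_apply, ← zpow_one_add, add_sub_cancel] at this
    exact this k

/-- The flat virtual tangle `E * E'` formed by the arcs of the concatenation: the curves of the
concatenation, restricted to the outer rows `0` and `2`. -/
def FlatTangle.comp {n : ℕ} (E E' : FlatTangle n) : FlatTangle n where
  rel := (stack E E').comap (rows ![0, 2])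
  pair := by
    intro x
    have hproj : ∀ x : Fin 2 × Fin n, proj (x.1, x) = rows ![0, 2] x := by
      rintro ⟨r, i⟩
      fin_cases r <;> simp [proj, rows]
    have hglue : ∀ x : Fin 2 × Fin n, glue n (x.1, x) = (x.1, x) := by
      rintro ⟨r, i⟩
      simp [glue_apply]
    have hfix : ∀ w, glue n w = w → w = (w.2.1, w.2) := by
      rintro ⟨k, r, i⟩ h
      by_cases hk : k = r
      · simp [hk]
      · simp [glue_apply, hk, Ne.symm hk] at h
    obtain ⟨y, ⟨h1, h2, h3⟩, h4⟩ := existsUnique_other_end (arcs E E') (glue n)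
      (fun w => Function.Involutive.toPerm_involutive _ w)
      (fun w => Function.Involutive.toPerm_involutive _ w)
      (by
        rintro ⟨k, u⟩ h
        by_cases hk : k = 0
        · simp [arcs_apply, hk, FlatTangle.partner_ne] at h
        · simp [arcs_apply, hk, FlatTangle.partner_ne] at h)
      (x.1, x) (hglue x)
    have hy := hfix y h2
    refine ⟨y.2, ⟨?_, ?_⟩, ?_⟩
    · intro h
      apply h1
      rw [hy, h]
    · rw [Setoid.comap_rel, ← hproj, ← hproj, stack_iff _ _ _ (hglue x), ← hy]
      obtain ⟨k, hk⟩ := h3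
      exact ⟨k, by rw [hk]⟩
    · rintro z ⟨hz1, hz2⟩
      rw [Setoid.comap_rel, ← hproj, ← hproj, stack_iff _ _ _ (hglue x)] at hz2
      obtain ⟨k, hk⟩ := hz2
      have hz : ((glue n * arcs E E') ^ k) (x.1, x) = (z.1, z) := by
        rcases eq_of_proj_eq hk.symm with h | h
        · exact h
        · rw [h, hglue]
      have := h4 (z.1, z) ⟨fun h => hz1 (congrArg Prod.snd h), hglue z, k, hz⟩
      rw [← this]

/-- The flat virtual tangle whose pairs are the orbits of a fixed-point-free involution. -/
def FlatTangle.ofInvolution {n : ℕ} (f : Fin 2 × Fin n → Fin 2 × Fin n)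
    (hf : ∀ x, f (f x) = x) (hne : ∀ x, f x ≠ x) : FlatTangle n where
  rel :=
    { r := fun x y => y = x ∨ y = f x
      iseqv :=
        { refl := fun x => Or.inl rfl
          symm := by
            rintro x y (rfl | rfl)
            · exact Or.inl rfl
            · exact Or.inr (hf x).symm
          trans := by
            rintro x y z (rfl | rfl) (rfl | rfl)
            · exact Or.inl rfl
            · exact Or.inr rfl
            · exact Or.inr rfl
            · exact Or.inl (hf x) } }
  pair := fun x => ⟨f x, ⟨hne x, Or.inr rfl⟩, fun _ h => h.2.resolve_left h.1⟩

/-- The identity tangle, with pairs `{(0, k), (1, k)}`. -/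
def FlatTangle.id (n : ℕ) : FlatTangle n :=
  .ofInvolution (fun x => (x.1.rev, x.2)) (fun x => by simp)
    (fun x h => by
      have := congrArg Prod.fst h
      obtain ⟨r, i⟩ := x
      fin_cases r <;> simp at this)

/-- The point `i` of `{1, …, n}` for `1 ≤ i ≤ n - 1` (counted from `0`). -/
def lo {n : ℕ} (i : Fin (n - 1)) : Fin n := ⟨i, by omega⟩

/-- The point `i + 1` of `{1, …, n}`. -/
def hi {n : ℕ} (i : Fin (n - 1)) : Fin n := ⟨i + 1, by omega⟩

/-- The tangle `v_i`, with pairs `{(0, i), (1, i + 1)}`, `{(0, i + 1), (1, i)}` and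
`{(0, k), (1, k)}` for `k ≠ i, i + 1`. -/
def FlatTangle.v {n : ℕ} (i : Fin (n - 1)) : FlatTangle n :=
  .ofInvolution (fun x => (x.1.rev, Equiv.swap (lo i) (hi i) x.2)) (fun x => by simp)
    (fun x h => by
      have := congrArg Prod.fst h
      obtain ⟨r, i⟩ := x
      fin_cases r <;> simp at this)

/-- The tangle `E_i`, with pairs `{(0, i), (0, i + 1)}`, `{(1, i), (1, i + 1)}` and
`{(0, k), (1, k)}` for `k ≠ i, i + 1`. -/
def FlatTangle.e {n : ℕ} (i : Fin (n - 1)) : FlatTangle n :=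
  .ofInvolution
    (fun x => if x.2 = lo i then (x.1, hi i) else if x.2 = hi i then (x.1, lo i)
      else (x.1.rev, x.2))
    (fun x => by
      have hne : hi i ≠ lo i := by simp [lo, hi]
      by_cases h : x.2 = lo i
      · obtain ⟨r, k⟩ := x
        simp only at h
        subst h
        simp [hne]
      · by_cases h' : x.2 = hi i
        · obtain ⟨r, k⟩ := x
          simp only at h'
          subst h'
          simp [hne]
        · simp [h, h'])
    (fun x hx => by
      have hne : hi i ≠ lo i := by simp [lo, hi]
      by_cases h : x.2 = lo i
      · rw [if_pos h] at hx
        exact hne ((congrArg Prod.snd hx).trans h)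
      · by_cases h' : x.2 = hi i
        · rw [if_neg h, if_pos h'] at hx
          exact hne ((congrArg Prod.snd hx).trans h').symm
        · rw [if_neg h, if_neg h'] at hx
          have := congrArg Prod.fst hx
          obtain ⟨r, i⟩ := x
          fin_cases r <;> simp at this)

/-! ### Associativity and unitality of the concatenation -/

theorem comap_sup {X Z : Type*} (r s : Setoid X) (ι : Z → X)
    (hs : ∀ x y, s x y → x = y ∨ (x ∈ Set.range ι ∧ y ∈ Set.range ι)) :
    (r ⊔ s).comap ι = r.comap ι ⊔ s.comap ι := by
  apply le_antisymm
  · intro x y hxy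
    let Q : X → Set Z := fun u => {z | ∃ z', r (ι z') u ∧ (r.comap ι ⊔ s.comap ι) z z'}
    have hr : ∀ u v, r u v → Q u ⊆ Q v := fun u v h z ⟨z', h1, h2⟩ => ⟨z', r.trans h1 h, h2⟩
    have hs' : ∀ u v, s u v → Q u ⊆ Q v := by
      intro u v h
      rcases hs u v h with rfl | ⟨⟨a, rfl⟩, ⟨b, rfl⟩⟩
      · exact subset_rfl
      · rintro z ⟨z', h1, h2⟩
        refine ⟨b, r.refl _, Setoid.trans' _ h2 (Setoid.trans' _
          ((le_sup_left : r.comap ι ≤ _) (show r (ι z') (ι a) from h1))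
          ((le_sup_right : s.comap ι ≤ _) (show s (ι a) (ι b) from h)))⟩
    have hle : r ⊔ s ≤ Setoid.ker Q := by
      refine sup_le (fun u v h => ?_) (fun u v h => ?_)
      · exact (hr u v h).antisymm (hr v u (r.symm h))
      · exact (hs' u v h).antisymm (hs' v u (s.symm h))
    have hQ : Q (ι x) = Q (ι y) := hle hxy
    have hx : x ∈ Q (ι x) := ⟨x, r.refl _, Setoid.refl' _ _⟩
    rw [hQ] at hx
    obtain ⟨z', h1, h2⟩ := hx
    exact Setoid.trans' _ h2 ((le_sup_left : r.comap ι ≤ _) (show r (ι z') (ι y) from h1))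
  · exact sup_le (fun x y h => (le_sup_left : r ≤ r ⊔ s) h)
      (fun x y h => (le_sup_right : s ≤ r ⊔ s) h)

theorem comap_map {X Z W U : Type*} (t : Setoid W) (ι : Z → X) (κ : W → X) (f : U → Z) (g : U → W)
    (hι : Function.Injective ι) (hκ : Function.Injective κ) (hf : Function.Injective f)
    (h : ∀ u, ι (f u) = κ (g u)) (h' : ∀ z w, ι z = κ w → ∃ u, f u = z ∧ g u = w) :
    (t.map κ).comap ι = (t.comap g).map f := by
  ext x y
  rw [Setoid.comap_rel, map_iff _ hκ, map_iff _ hf, hι.eq_iff]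
  refine or_congr Iff.rfl ⟨?_, ?_⟩
  · rintro ⟨p, q, hpq, h1, h2⟩
    obtain ⟨u, rfl, rfl⟩ := h' x p h1.symm
    obtain ⟨u', rfl, rfl⟩ := h' y q h2.symm
    exact ⟨u, u', hpq, rfl, rfl⟩
  · rintro ⟨u, u', hu, rfl, rfl⟩
    exact ⟨g u, g u', hu, (h u).symm, (h u').symm⟩

theorem mem_classes_iff {X : Type*} (r : Setoid X) (C : Set X) :
    C ∈ r.classes ↔ ∃ y, C = {x | r x y} := Iff.rfl

theorem ncard_classes_sup {X Z : Type*} [Finite X] (r s : Setoid X) (ι : Z → X)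
    (hs : ∀ x y, s x y → x = y ∨ (x ∈ Set.range ι ∧ y ∈ Set.range ι))
    (O : Set X) (hO : O ⊆ Set.range ι) :
    {C | C ∈ (r ⊔ s).classes ∧ ∀ p ∈ C, p ∉ O}.ncard =
      {C | C ∈ r.classes ∧ ∀ p ∈ C, p ∉ Set.range ι}.ncard +
      {C | C ∈ ((r ⊔ s).comap ι).classes ∧ ∀ p ∈ C, ι p ∉ O}.ncard := by
  have hclass : ∀ y, (∀ p, r p y → p ∉ Set.range ι) → ∀ x, (r ⊔ s) x y → r x y := by
    intro y hy x hxy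
    have hle : r ⊔ s ≤ Setoid.ker (fun u => r u y) := by
      refine sup_le (fun u v h => ?_) (fun u v h => ?_)
      · exact propext ⟨fun h' => r.trans (r.symm h) h', fun h' => r.trans h h'⟩
      · rcases hs u v h with rfl | ⟨hu, hv⟩
        · rfl
        · exact propext ⟨fun h' => absurd hu (hy _ h'), fun h' => absurd hv (hy _ h')⟩
    exact (hle hxy).mpr (r.refl y)
  have hclass' : ∀ y, (∀ p, (r ⊔ s) p y → p ∉ Set.range ι) → ∀ x, (r ⊔ s) x y → r x y :=
    fun y hy => hclass y fun p hp => hy p ((le_sup_left : r ≤ r ⊔ s) hp)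
  have hsplit : {C | C ∈ (r ⊔ s).classes ∧ ∀ p ∈ C, p ∉ O} =
      {C | C ∈ r.classes ∧ ∀ p ∈ C, p ∉ Set.range ι} ∪
      {C | C ∈ (r ⊔ s).classes ∧ (∀ p ∈ C, p ∉ O) ∧ ∃ z, ι z ∈ C} := by
    ext C
    simp only [Set.mem_ofPred_eq, Set.mem_union, mem_classes_iff]
    constructor
    · rintro ⟨⟨y, rfl⟩, h⟩
      by_cases hz : ∃ z, ι z ∈ {x | (r ⊔ s) x y}
      · exact Or.inr ⟨⟨y, rfl⟩, h, hz⟩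
      · have hz' : ∀ p, (r ⊔ s) p y → p ∉ Set.range ι := by
          rintro _ hp ⟨z, rfl⟩
          exact hz ⟨z, hp⟩
        refine Or.inl ⟨⟨y, ?_⟩, hz'⟩
        ext x
        exact ⟨hclass' y hz' x, fun hx => (le_sup_left : r ≤ r ⊔ s) hx⟩
    · rintro (⟨⟨y, rfl⟩, h⟩ | ⟨h1, h2, h3⟩)
      · refine ⟨⟨y, ?_⟩, fun p hp hpO => h p hp (hO hpO)⟩
        ext x
        exact ⟨fun hx => (le_sup_left : r ≤ r ⊔ s) hx, hclass y h x⟩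
      · exact ⟨h1, h2⟩
  rw [hsplit, Set.ncard_union_eq]
  · congr 1
    refine Set.ncard_congr (fun C _ => ι ⁻¹' C) ?_ ?_ ?_
    · rintro _ ⟨⟨y, rfl⟩, h2, z, hz⟩
      refine ⟨⟨z, ?_⟩, fun p hp => h2 _ hp⟩
      ext x
      exact ⟨fun hx => (r ⊔ s).trans' (show (r ⊔ s) (ι x) y from hx) ((r ⊔ s).symm' hz),
        fun hx => (r ⊔ s).trans' (show (r ⊔ s) (ι x) (ι z) from hx) hz⟩
    · rintro C C' ⟨h1, h2, z, hz⟩ ⟨h1', h2', _⟩ h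
      have hz' : z ∈ ι ⁻¹' C' := h ▸ hz
      exact Setoid.eq_of_mem_classes h1 hz h1' hz'
    · rintro _ ⟨⟨z, rfl⟩, h⟩
      refine ⟨{x | (r ⊔ s) x (ι z)}, ⟨⟨ι z, rfl⟩, ?_, z, (r ⊔ s).refl' _⟩, rfl⟩
      intro p hp hpO
      obtain ⟨z', rfl⟩ := hO hpO
      exact h z' hp hpO
  · rw [Set.disjoint_left]
    rintro C ⟨_, h⟩ ⟨_, _, z, hz⟩
    exact h _ hz ⟨z, rfl⟩

theorem ncard_classes_map {X W : Type*} (t : Setoid W) {κ : W → X}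
    (hκ : Function.Injective κ) (P : Set X) (hP : ∀ x, x ∉ Set.range κ → x ∈ P) :
    {C | C ∈ (t.map κ).classes ∧ ∀ p ∈ C, p ∉ P}.ncard =
      {C | C ∈ t.classes ∧ ∀ p ∈ C, κ p ∉ P}.ncard := by
  symm
  have himg : ∀ w, κ '' {x | t x w} = {x | t.map κ x (κ w)} := by
    intro w
    ext x
    simp only [Set.mem_image, Set.mem_ofPred_eq, map_iff t hκ]
    constructor
    · rintro ⟨p, hp, rfl⟩
      exact Or.inr ⟨p, w, hp, rfl, rfl⟩
    · rintro (rfl | ⟨p, q, hpq, rfl, hq⟩)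
      · exact ⟨w, t.refl w, rfl⟩
      · exact ⟨p, hκ hq ▸ hpq, rfl⟩
  refine Set.ncard_congr (fun C _ => κ '' C) ?_ ?_ ?_
  · rintro _ ⟨⟨w, rfl⟩, h⟩
    refine ⟨⟨κ w, himg w⟩, ?_⟩
    rintro _ ⟨p, hp, rfl⟩
    exact h p hp
  · intro C C' _ _ h
    exact hκ.image_injective h
  · rintro _ ⟨⟨x, rfl⟩, h⟩
    have hx : x ∈ Set.range κ := by
      by_contra hx
      exact h x ((t.map κ).refl' x) (hP x hx)
    obtain ⟨w, rfl⟩ := hx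
    refine ⟨{x | t x w}, ⟨⟨w, rfl⟩, fun p hp => h _ (map_rel t κ hp)⟩, himg w⟩

theorem mem_range_rows {k l n : ℕ} (e : Fin k → Fin l) (x : Fin l × Fin n) :
    x ∈ Set.range (rows e) ↔ x.1 ∈ Set.range e := by
  constructor
  · rintro ⟨p, rfl⟩
    exact ⟨p.1, rfl⟩
  · rintro ⟨a, h⟩
    exact ⟨(a, x.2), Prod.ext h rfl⟩

theorem map_supp {k l m n : ℕ} (E : Setoid (Fin k × Fin n)) {e : Fin k → Fin l}
    (he : Function.Injective e) {ι : Fin m → Fin l} (h : Set.range e ⊆ Set.range ι)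
    (x y : Fin l × Fin n) (hxy : E.map (rows e) x y) :
    x = y ∨ (x ∈ Set.range (rows ι : Fin m × Fin n → _) ∧
      y ∈ Set.range (rows ι : Fin m × Fin n → _)) := by
  rcases (map_iff E (rows_injective he) x y).1 hxy with h' | ⟨p, q, _, rfl, rfl⟩
  · exact Or.inl h'
  · refine Or.inr ⟨?_, ?_⟩ <;> rw [mem_range_rows] <;> exact h ⟨_, rfl⟩

theorem comap_map_rows {k l m u n : ℕ} (t : Setoid (Fin k × Fin n))
    (ι : Fin l → Fin m) (κ : Fin k → Fin m) (f : Fin u → Fin l) (g : Fin u → Fin k)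
    (hι : Function.Injective ι) (hκ : Function.Injective κ) (hf : Function.Injective f)
    (h : ∀ a, ι (f a) = κ (g a)) (h' : ∀ a b, ι a = κ b → ∃ c, f c = a ∧ g c = b) :
    (t.map (rows κ)).comap (rows ι) = (t.comap (rows g)).map (rows f) := by
  refine comap_map t _ _ _ _ (rows_injective hι) (rows_injective hκ) (rows_injective hf) ?_ ?_
  · rintro ⟨a, i⟩
    simp [rows, h]
  · rintro ⟨a, i⟩ ⟨b, j⟩ hab
    simp only [rows, Prod.mk.injEq] at hab
    obtain ⟨c, rfl, rfl⟩ := h' a b hab.1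
    exact ⟨(c, i), rfl, by simp [rows, hab.2]⟩

/-- The concatenation of three diagrams. -/
def stack₃ {n : ℕ} (E E' E'' : FlatTangle n) : Setoid (Fin 4 × Fin n) :=
  E.rel.map (rows ![0, 1]) ⊔ E'.rel.map (rows ![1, 2]) ⊔ E''.rel.map (rows ![2, 3])

theorem stack₃_left {n : ℕ} (E E' E'' : FlatTangle n) :
    stack₃ E E' E'' = (stack E E').map (rows ![0, 1, 2]) ⊔ E''.rel.map (rows ![2, 3]) := by
  have h1 : (![0, 1, 2] : Fin 3 → Fin 4) ∘ ![0, 1] = ![0, 1] := by decide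
  have h2 : (![0, 1, 2] : Fin 3 → Fin 4) ∘ ![1, 2] = ![1, 2] := by decide
  rw [stack₃, stack, map_sup, map_map, map_map, rows_comp, rows_comp, h1, h2]

theorem stack₃_right {n : ℕ} (E E' E'' : FlatTangle n) :
    stack₃ E E' E'' = (stack E' E'').map (rows ![1, 2, 3]) ⊔ E.rel.map (rows ![0, 1]) := by
  have h1 : (![1, 2, 3] : Fin 3 → Fin 4) ∘ ![0, 1] = ![1, 2] := by decide
  have h2 : (![1, 2, 3] : Fin 3 → Fin 4) ∘ ![1, 2] = ![2, 3] := by decide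
  rw [stack₃, stack, map_sup, map_map, map_map, rows_comp, rows_comp, h1, h2, sup_comm _ (E.rel.map _),
    sup_assoc]

theorem comap_id' {X : Type*} (t : Setoid X) (f : X → X) (hf : ∀ x, f x = x) : t.comap f = t := by
  ext x y
  rw [Setoid.comap_rel, hf, hf]

theorem supp_left : Set.range (![2, 3] : Fin 2 → Fin 4) ⊆ Set.range (![0, 2, 3] : Fin 3 → Fin 4) := by
  rintro _ ⟨a, rfl⟩
  fin_cases a
  · exact ⟨1, rfl⟩
  · exact ⟨2, rfl⟩

theorem supp_right : Set.range (![0, 1] : Fin 2 → Fin 4) ⊆ Set.range (![0, 1, 3] : Fin 3 → Fin 4) := by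
  rintro _ ⟨a, rfl⟩
  fin_cases a
  · exact ⟨0, rfl⟩
  · exact ⟨1, rfl⟩

theorem comap_stack₃_left {n : ℕ} (E E' E'' : FlatTangle n) :
    (stack₃ E E' E'').comap (rows ![0, 2, 3]) = stack (E.comp E') E'' := by
  rw [stack₃_left, comap_sup _ _ _ (map_supp _ (by decide) supp_left),
    comap_map_rows (stack E E') ![0, 2, 3] ![0, 1, 2] ![0, 1] ![0, 2] (by decide) (by decide)
      (by decide) (by decide) (by decide),
    comap_map_rows E''.rel ![0, 2, 3] ![2, 3] ![1, 2] ![0, 1] (by decide) (by decide)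
      (by decide) (by decide) (by decide),
    comap_id' E''.rel (rows ![0, 1]) (by rintro ⟨a, i⟩; fin_cases a <;> rfl)]
  rfl

theorem comap_stack₃_right {n : ℕ} (E E' E'' : FlatTangle n) :
    (stack₃ E E' E'').comap (rows ![0, 1, 3]) = stack E (E'.comp E'') := by
  rw [stack₃_right, comap_sup _ _ _ (map_supp _ (by decide) supp_right),
    comap_map_rows (stack E' E'') ![0, 1, 3] ![1, 2, 3] ![1, 2] ![0, 2] (by decide) (by decide)
      (by decide) (by decide) (by decide),
    comap_map_rows E.rel ![0, 1, 3] ![0, 1] ![0, 1] ![0, 1] (by decide) (by decide)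
      (by decide) (by decide) (by decide),
    comap_id' E.rel (rows ![0, 1]) (by rintro ⟨a, i⟩; fin_cases a <;> rfl), sup_comm]
  rfl

theorem comp_assoc {n : ℕ} (E E' E'' : FlatTangle n) :
    (E.comp E').comp E'' = E.comp (E'.comp E'') := by
  apply FlatTangle.ext
  change (stack (E.comp E') E'').comap (rows ![0, 2]) = (stack E (E'.comp E'')).comap (rows ![0, 2])
  rw [← comap_stack₃_left, ← comap_stack₃_right]
  ext ⟨a, i⟩ ⟨b, j⟩
  fin_cases a <;> fin_cases b <;> rfl

theorem loops_assoc_left {n : ℕ} (E E' E'' : FlatTangle n) :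
    {C | C ∈ (stack₃ E E' E'').classes ∧ ∀ p ∈ C, p ∉ {p : Fin 4 × Fin n | p.1 = 0 ∨ p.1 = 3}}.ncard
      = loops E E' + loops (E.comp E') E'' := by
  have hO : {p : Fin 4 × Fin n | p.1 = 0 ∨ p.1 = 3} ⊆ Set.range (rows ![0, 2, 3]) := by
    rintro ⟨a, i⟩ (h | h) <;> rw [mem_range_rows] <;> simp only at h <;> subst h
    · exact ⟨0, rfl⟩
    · exact ⟨2, rfl⟩
  rw [stack₃_left, ncard_classes_sup _ _ (rows ![0, 2, 3]) (map_supp _ (by decide) supp_left) _ hO,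
    ← stack₃_left, comap_stack₃_left, ncard_classes_map _ (rows_injective (by decide))]
  · congr 1
    · unfold loops
      congr 1
      ext C
      refine and_congr Iff.rfl (forall₂_congr fun p _ => ?_)
      rw [mem_range_rows]
      obtain ⟨a, i⟩ := p
      fin_cases a <;> simp [rows]
    · unfold loops
      congr 1
      ext C
      refine and_congr Iff.rfl (forall₂_congr fun p _ => ?_)
      obtain ⟨a, i⟩ := p
      fin_cases a <;> simp [rows]
  · rintro ⟨a, i⟩ h
    rw [mem_range_rows] at h ⊢
    revert h
    fin_cases a <;> simp

theorem loops_assoc_right {n : ℕ} (E E' E'' : FlatTangle n) :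
    {C | C ∈ (stack₃ E E' E'').classes ∧ ∀ p ∈ C, p ∉ {p : Fin 4 × Fin n | p.1 = 0 ∨ p.1 = 3}}.ncard
      = loops E' E'' + loops E (E'.comp E'') := by
  have hO : {p : Fin 4 × Fin n | p.1 = 0 ∨ p.1 = 3} ⊆ Set.range (rows ![0, 1, 3]) := by
    rintro ⟨a, i⟩ (h | h) <;> rw [mem_range_rows] <;> simp only at h <;> subst h
    · exact ⟨0, rfl⟩
    · exact ⟨2, rfl⟩
  rw [stack₃_right, ncard_classes_sup _ _ (rows ![0, 1, 3]) (map_supp _ (by decide) supp_right) _ hO,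
    ← stack₃_right, comap_stack₃_right, ncard_classes_map _ (rows_injective (by decide))]
  · congr 1
    · unfold loops
      congr 1
      ext C
      refine and_congr Iff.rfl (forall₂_congr fun p _ => ?_)
      rw [mem_range_rows]
      obtain ⟨a, i⟩ := p
      fin_cases a <;> simp [rows]
    · unfold loops
      congr 1
      ext C
      refine and_congr Iff.rfl (forall₂_congr fun p _ => ?_)
      obtain ⟨a, i⟩ := p
      fin_cases a <;> simp [rows]
  · rintro ⟨a, i⟩ h
    rw [mem_range_rows] at h ⊢
    revert h
    fin_cases a <;> simp

theorem id_rel {n : ℕ} (x y : Fin 2 × Fin n) : (FlatTangle.id n).rel x y ↔ x.2 = y.2 := by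
  change (y = x ∨ y = (x.1.rev, x.2)) ↔ _
  obtain ⟨a, i⟩ := x
  obtain ⟨b, j⟩ := y
  fin_cases a <;> fin_cases b <;> simp [eq_comm]

theorem stack_id_left {n : ℕ} (E : FlatTangle n) :
    stack (.id n) E = E.rel.comap (rows ![0, 0, 1]) := by
  apply le_antisymm
  · refine sup_le ((map_le_iff _ _ _).2 ?_) ((map_le_iff _ _ _).2 ?_)
    · rintro ⟨a, i⟩ ⟨b, j⟩ h
      rw [id_rel] at h
      simp only at h
      subst h
      fin_cases a <;> fin_cases b <;> exact E.rel.refl _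
    · rintro ⟨a, i⟩ ⟨b, j⟩ h
      fin_cases a <;> fin_cases b <;> exact h
  · have key : ∀ x : Fin 3 × Fin n, stack (.id n) E x (rows ![1, 2] (rows ![0, 0, 1] x)) := by
      rintro ⟨a, i⟩
      fin_cases a
      · exact (le_sup_left : _ ≤ stack (.id n) E)
          (map_rel (FlatTangle.id n).rel (rows ![0, 1]) ((id_rel (0, i) (1, i)).2 rfl))
      · exact Setoid.refl' _ _
      · exact Setoid.refl' _ _
    intro x y h
    exact Setoid.trans' _ (key x) (Setoid.trans' _
      ((le_sup_right : _ ≤ stack (.id n) E) (map_rel E.rel (rows ![1, 2]) h))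
      (Setoid.symm' _ (key y)))

theorem stack_id_right {n : ℕ} (E : FlatTangle n) :
    stack E (.id n) = E.rel.comap (rows ![0, 1, 1]) := by
  apply le_antisymm
  · refine sup_le ((map_le_iff _ _ _).2 ?_) ((map_le_iff _ _ _).2 ?_)
    · rintro ⟨a, i⟩ ⟨b, j⟩ h
      fin_cases a <;> fin_cases b <;> exact h
    · rintro ⟨a, i⟩ ⟨b, j⟩ h
      rw [id_rel] at h
      simp only at h
      subst h
      fin_cases a <;> fin_cases b <;> exact E.rel.refl _
  · have key : ∀ x : Fin 3 × Fin n, stack E (.id n) x (rows ![0, 1] (rows ![0, 1, 1] x)) := by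
      rintro ⟨a, i⟩
      fin_cases a
      · exact Setoid.refl' _ _
      · exact Setoid.refl' _ _
      · exact (le_sup_right : _ ≤ stack E (.id n))
          (map_rel (FlatTangle.id n).rel (rows ![1, 2]) ((id_rel (1, i) (0, i)).2 rfl))
    intro x y h
    exact Setoid.trans' _ (key x) (Setoid.trans' _
      ((le_sup_left : _ ≤ stack E (.id n)) (map_rel E.rel (rows ![0, 1]) h))
      (Setoid.symm' _ (key y)))

theorem id_comp {n : ℕ} (E : FlatTangle n) : (FlatTangle.id n).comp E = E := by
  apply FlatTangle.ext
  change (stack (.id n) E).comap (rows ![0, 2]) = E.rel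
  rw [stack_id_left]
  ext ⟨a, i⟩ ⟨b, j⟩
  fin_cases a <;> fin_cases b <;> rfl

theorem comp_id {n : ℕ} (E : FlatTangle n) : E.comp (.id n) = E := by
  apply FlatTangle.ext
  change (stack E (.id n)).comap (rows ![0, 2]) = E.rel
  rw [stack_id_right]
  ext ⟨a, i⟩ ⟨b, j⟩
  fin_cases a <;> fin_cases b <;> rfl

theorem loops_eq_zero {n : ℕ} {E E' : FlatTangle n}
    (h : ∀ i, ∃ p, p.1 ≠ 1 ∧ stack E E' p (1, i)) : loops E E' = 0 := by
  have : {C | C ∈ (stack E E').classes ∧ ∀ p ∈ C, p.1 = 1} = ∅ := by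
    rw [Set.eq_empty_iff_forall_notMem]
    rintro _ ⟨⟨⟨a, i⟩, rfl⟩, hC⟩
    have ha : a = 1 := hC (a, i) ((stack E E').refl' _)
    subst ha
    obtain ⟨p, hp, hp'⟩ := h i
    exact hp (hC p hp')
  rw [loops, this, Set.ncard_empty]

theorem loops_id_left {n : ℕ} (E : FlatTangle n) : loops (.id n) E = 0 := by
  refine loops_eq_zero fun i => ⟨(0, i), by simp, ?_⟩
  rw [stack_id_left]
  exact E.rel.refl _

theorem loops_id_right {n : ℕ} (E : FlatTangle n) : loops E (.id n) = 0 := by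
  refine loops_eq_zero fun i => ⟨(2, i), by simp, ?_⟩
  rw [stack_id_right]
  exact E.rel.refl _

/-! ### The virtual Temperley--Lieb algebra -/

/-- The free `ℤ[z]`-module on the flat virtual `n`-tangles. -/
def VTL (n : ℕ) : Type := FlatTangle n →₀ ℤ[X]

instance (n : ℕ) : AddCommGroup (VTL n) := inferInstanceAs (AddCommGroup (FlatTangle n →₀ ℤ[X]))

instance (n : ℕ) : Module ℤ[X] (VTL n) := inferInstanceAs (Module ℤ[X] (FlatTangle n →₀ ℤ[X]))

/-- A flat virtual tangle as an element of the algebra. -/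
def VTL.of {n : ℕ} (E : FlatTangle n) : VTL n := Finsupp.single E (1 : ℤ[X])

/-- The flat virtual tangles form a basis. -/
def VTL.basis (n : ℕ) : Module.Basis (FlatTangle n) ℤ[X] (VTL n) := ⟨LinearEquiv.refl ℤ[X] _⟩

theorem VTL.basis_apply {n : ℕ} (E : FlatTangle n) : VTL.basis n E = VTL.of E := rfl

/-- The multiplication: the bilinear map with `E E' = z ^ m (E * E')`, where `m` is the number of
closed curves in the concatenation of `E` and `E'`. -/
def VTL.mulHom (n : ℕ) : VTL n →ₗ[ℤ[X]] VTL n →ₗ[ℤ[X]] VTL n :=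
  (VTL.basis n).constr ℤ[X] fun E => (VTL.basis n).constr ℤ[X] fun E' =>
    (X : ℤ[X]) ^ loops E E' • VTL.of (E.comp E')

instance (n : ℕ) : Mul (VTL n) := ⟨fun x y => VTL.mulHom n x y⟩

instance (n : ℕ) : One (VTL n) := ⟨VTL.of (.id n)⟩

theorem VTL.mul_def {n : ℕ} (x y : VTL n) : x * y = VTL.mulHom n x y := rfl

theorem VTL.of_mul_of {n : ℕ} (E E' : FlatTangle n) :
    VTL.of E * VTL.of E' = (X : ℤ[X]) ^ loops E E' • VTL.of (E.comp E') := by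
  rw [VTL.mul_def, ← VTL.basis_apply, ← VTL.basis_apply E', VTL.mulHom, Module.Basis.constr_basis,
    Module.Basis.constr_basis]

theorem VTL.induction {n : ℕ} {p : VTL n → Prop} (x : VTL n) (zero : p 0)
    (add : ∀ x y, p x → p y → p (x + y)) (of : ∀ (a : ℤ[X]) E, p (a • VTL.of E)) : p x := by
  have hx : x ∈ Submodule.span ℤ[X] (Set.range (VTL.basis n)) := by
    rw [(VTL.basis n).span_eq]; trivial
  obtain ⟨c, rfl⟩ := (Finsupp.mem_span_range_iff_exists_finsupp).1 hx
  exact Finset.sum_induction _ p add zero (fun E _ => of _ E)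

theorem VTL.smul_mul {n : ℕ} (a : ℤ[X]) (x y : VTL n) : (a • x) * y = a • (x * y) := by
  simp only [VTL.mul_def, map_smul, LinearMap.smul_apply]

theorem VTL.mul_smul {n : ℕ} (a : ℤ[X]) (x y : VTL n) : x * (a • y) = a • (x * y) := by
  simp only [VTL.mul_def, map_smul]

theorem VTL.add_mul' {n : ℕ} (x y z : VTL n) : (x + y) * z = x * z + y * z := by
  simp only [VTL.mul_def, map_add, LinearMap.add_apply]

theorem VTL.mul_add' {n : ℕ} (x y z : VTL n) : x * (y + z) = x * y + x * z := by
  simp only [VTL.mul_def, map_add]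

theorem VTL.zero_mul' {n : ℕ} (x : VTL n) : 0 * x = 0 := by
  simp only [VTL.mul_def, map_zero, LinearMap.zero_apply]

theorem VTL.mul_zero' {n : ℕ} (x : VTL n) : x * 0 = 0 := by
  simp only [VTL.mul_def, map_zero]

theorem VTL.one_mul' {n : ℕ} (x : VTL n) : 1 * x = x := by
  refine VTL.induction (p := fun x => 1 * x = x) x (VTL.mul_zero' 1) (fun x y hx hy => ?_) (fun a E => ?_)
  · rw [VTL.mul_add', hx, hy]
  · rw [VTL.mul_smul, show (1 : VTL n) = VTL.of (.id n) from rfl, VTL.of_mul_of, loops_id_left,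
      id_comp, pow_zero, one_smul]

theorem VTL.mul_one' {n : ℕ} (x : VTL n) : x * 1 = x := by
  refine VTL.induction (p := fun x => x * 1 = x) x (VTL.zero_mul' 1) (fun x y hx hy => ?_) (fun a E => ?_)
  · rw [VTL.add_mul', hx, hy]
  · rw [VTL.smul_mul, show (1 : VTL n) = VTL.of (.id n) from rfl, VTL.of_mul_of, loops_id_right,
      comp_id, pow_zero, one_smul]

theorem VTL.mul_assoc' {n : ℕ} (x y z : VTL n) : x * y * z = x * (y * z) := by
  refine VTL.induction (p := fun x => x * y * z = x * (y * z)) x (by simp only [VTL.zero_mul'])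
    (fun _ _ h h' => by simp only [VTL.add_mul', h, h']) (fun a E => ?_)
  refine VTL.induction (p := fun y => a • of E * y * z = a • of E * (y * z)) y (by simp only [VTL.zero_mul', VTL.mul_zero'])
    (fun _ _ h h' => by simp only [VTL.add_mul', VTL.mul_add', h, h']) (fun b E' => ?_)
  refine VTL.induction
    (p := fun z => a • of E * b • of E' * z = a • of E * (b • of E' * z)) z (by simp only [VTL.mul_zero'])
    (fun _ _ h h' => by simp only [VTL.mul_add', h, h']) (fun c E'' => ?_)
  simp only [VTL.smul_mul, VTL.mul_smul, VTL.of_mul_of, smul_smul, comp_assoc]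
  congr 1
  have h := (loops_assoc_left E E' E'').symm.trans (loops_assoc_right E E' E'')
  have h' : (X : ℤ[X]) ^ loops E E' * X ^ loops (E.comp E') E'' =
      X ^ loops E' E'' * X ^ loops E (E'.comp E'') := by rw [← pow_add, ← pow_add, h]
  linear_combination a * b * c * h'

/-- The `n`-th virtual Temperley--Lieb algebra is an associative unital ring. -/
instance (n : ℕ) : Ring (VTL n) :=
  { (inferInstance : AddCommGroup (VTL n)) with
    mul := (· * ·)
    one := 1
    left_distrib := VTL.mul_add'
    right_distrib := VTL.add_mul'
    zero_mul := VTL.zero_mul'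
    mul_zero := VTL.mul_zero'
    mul_assoc := VTL.mul_assoc'
    one_mul := VTL.one_mul'
    mul_one := VTL.mul_one' }

/-- The `n`-th virtual Temperley--Lieb algebra, over `ℤ[z]`, with `z` the variable of `ℤ[X]`. -/
instance (n : ℕ) : Algebra ℤ[X] (VTL n) := Algebra.ofModule VTL.smul_mul fun a x y => VTL.mul_smul a x y

/-! ### The presented algebra -/

/-- The generators `E_i`, `v_i`, `1 ≤ i ≤ n - 1` (counted from `0`). -/
inductive Gen (n : ℕ) : Type
  | E (i : Fin (n - 1)) : Gen n
  | v (i : Fin (n - 1)) : Gen n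

/-- The generator `E_i` of the free algebra. -/
abbrev gE {n : ℕ} (i : Fin (n - 1)) : FreeAlgebra ℤ[X] (Gen n) := FreeAlgebra.ι ℤ[X] (Gen.E i)

/-- The generator `v_i` of the free algebra. -/
abbrev gv {n : ℕ} (i : Fin (n - 1)) : FreeAlgebra ℤ[X] (Gen n) := FreeAlgebra.ι ℤ[X] (Gen.v i)

/-- The defining relations. -/
inductive Rel (n : ℕ) : FreeAlgebra ℤ[X] (Gen n) → FreeAlgebra ℤ[X] (Gen n) → Prop
  | E_sq (i : Fin (n - 1)) : Rel n (gE i * gE i) ((X : ℤ[X]) • gE i)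
  | v_sq (i : Fin (n - 1)) : Rel n (gv i * gv i) 1
  | E_v (i : Fin (n - 1)) : Rel n (gE i * gv i) (gE i)
  | v_E (i : Fin (n - 1)) : Rel n (gv i * gE i) (gE i)
  | E_E_far (i j : Fin (n - 1)) (h : 2 ≤ |((i : ℕ) : ℤ) - ((j : ℕ) : ℤ)|) : Rel n (gE i * gE j) (gE j * gE i)
  | v_v_far (i j : Fin (n - 1)) (h : 2 ≤ |((i : ℕ) : ℤ) - ((j : ℕ) : ℤ)|) : Rel n (gv i * gv j) (gv j * gv i)
  | v_E_far (i j : Fin (n - 1)) (h : 2 ≤ |((i : ℕ) : ℤ) - ((j : ℕ) : ℤ)|) : Rel n (gv i * gE j) (gE j * gv i)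
  | E_v_E (i j : Fin (n - 1)) (h : |((i : ℕ) : ℤ) - ((j : ℕ) : ℤ)| = 1) : Rel n (gE i * gv j * gE i) (gE i)
  | v_v_v (i j : Fin (n - 1)) (h : |((i : ℕ) : ℤ) - ((j : ℕ) : ℤ)| = 1) : Rel n (gv i * gv j * gv i) (gv j * gv i * gv j)
  | v_v_E (i j : Fin (n - 1)) (h : |((i : ℕ) : ℤ) - ((j : ℕ) : ℤ)| = 1) : Rel n (gv i * gv j * gE i) (gE j * gv i * gv j)

/-- The unital associative `ℤ[z]`-algebra with the generators `Gen n` and the relations `Rel n`. -/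
abbrev Presented (n : ℕ) : Type := RingQuot (Rel n)

/-- The class of a generator in the presented algebra. -/
def Presented.gen {n : ℕ} (g : Gen n) : Presented n :=
  RingQuot.mkAlgHom ℤ[X] (Rel n) (FreeAlgebra.ι ℤ[X] g)

end VirtualTL

end

open Polynomial

noncomputable section

namespace VirtualTL

open Equiv

/-! A tangle is encoded by two permutations of the columns: the involution `μ` whose 2-cycles are
the arcs of row 0, and a permutation `σ` that carries the arcs of row 1 to these arcs and the lower
end of each through strand to its upper end. So a tangle is a product of disjoint arcs, each a
conjugate of `E_1`, followed by a permutation. Here `μ` is unique, and `σ` is unique up to left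
multiplication by permutations that commute with `μ` and fix its fixed points. Those are generated
by flips of one arc and exchanges of two arcs.

The presented algebra has the same normal form. The Coxeter relations among the `v_i` give a
homomorphism `perm` from the symmetric group (`permLift`). Since `E_1` commutes with every
permutation fixing its two points, a conjugate of `E_1` depends only on the images `a`, `b` of these
points; this is `arc a b`. The other relations become rules for arcs: disjoint arcs commute, arcs
absorb their flip, and `arc a b * arc b c = arc a b * perm (swap a c)`. Hence a product of disjoint
arcs depends only on `μ` (`ArcProd.unique`), and it absorbs on the right exactly the ambiguity of
`σ` (`ArcProd.mul_perm`). Each tangle therefore has a well-defined word (`Represents.unique`).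

The linear map `fromVTL` sends a tangle to its word. Multiplying a tangle by a generator on the left
follows the same case distinction as multiplying its word (`Represents.v_comp`,
`Represents.e_comp`), so `fromVTL` respects left multiplication by the presented algebra. As it
sends 1 to 1, it is a left inverse of `toVTL`, which is thus injective. Surjectivity holds because a
tangle of any prescribed shape can be built from the generators. -/

/-! ### Permutations and adjacent transpositions -/

/-- The transposition of two neighbouring points. -/
def adj {n : ℕ} (i : Fin (n - 1)) : Perm (Fin n) := swap (lo i) (hi i)

theorem lo_ne_hi {n : ℕ} (i : Fin (n - 1)) : lo i ≠ hi i := by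
  simp [lo, hi]

theorem lo_lt_hi {n : ℕ} (i : Fin (n - 1)) : lo i < hi i := by
  simp [lo, hi]

@[simp] theorem adj_lo {n : ℕ} (i : Fin (n - 1)) : adj i (lo i) = hi i := swap_apply_left _ _

@[simp] theorem adj_hi {n : ℕ} (i : Fin (n - 1)) : adj i (hi i) = lo i := swap_apply_right _ _

@[simp] theorem adj_mul_adj {n : ℕ} (i : Fin (n - 1)) : adj i * adj i = 1 := swap_mul_self _ _

@[simp] theorem adj_inv {n : ℕ} (i : Fin (n - 1)) : (adj i)⁻¹ = adj i := swap_inv _ _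

theorem adj_of_ne {n : ℕ} {i : Fin (n - 1)} {k : Fin n} (h : k ≠ lo i) (h' : k ≠ hi i) :
    adj i k = k := swap_apply_of_ne_of_ne h h'

/-- The first place where the two sequences of values differ is `lo i`, and there the value drops.
The lexicographic order thus serves as the measure for removing descents, in place of the number of
inversions. -/
theorem lex_lt_of_descent {n : ℕ} {ρ : Perm (Fin n)} {i : Fin (n - 1)} (h : ρ (hi i) < ρ (lo i)) :
    toLex ⇑(ρ * adj i) < toLex ⇑ρ := by
  refine ⟨lo i, fun j hj => ?_, ?_⟩
  · have h1 : j ≠ hi i := (hj.trans (lo_lt_hi i)).ne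
    exact congrArg ρ (adj_of_ne hj.ne h1)
  · simpa using h

/-- Without descents the permutation is strictly increasing, and a finite linear order has only one
automorphism. -/
theorem eq_one_of_no_descent {n : ℕ} (ρ : Perm (Fin n)) (h : ∀ i : Fin (n - 1), ¬ ρ (hi i) < ρ (lo i)) :
    ρ = 1 := by
  rcases n with _ | n
  · exact Subsingleton.elim _ _
  · have hm : StrictMono ρ := Fin.strictMono_iff_lt_succ.2 fun i =>
      lt_of_le_of_ne (not_lt.1 (h i)) (ρ.injective.ne (lo_ne_hi (n := n + 1) i))
    have : StrictMono.orderIsoOfSurjective ρ hm ρ.surjective = OrderIso.refl _ :=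
      Subsingleton.elim _ _
    ext x
    exact congrArg (fun f : Fin (n + 1) ≃o Fin (n + 1) => (f x : ℕ)) this

/-- Induction on permutations by removing descents. -/
theorem descent_induction {n : ℕ} {p : Perm (Fin n) → Prop} (one : p 1)
    (step : ∀ ρ i, ρ (hi i) < ρ (lo i) → p (ρ * adj i) → p ρ) (ρ : Perm (Fin n)) : p ρ := by
  have wf : WellFounded fun ρ ρ' : Perm (Fin n) => toLex ⇑ρ < toLex ⇑ρ' :=
    InvImage.wf (fun ρ : Perm (Fin n) => toLex ⇑ρ) wellFounded_lt
  induction ρ using wf.induction with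
  | _ ρ ih =>
    by_cases h : ∃ i, ρ (hi i) < ρ (lo i)
    · obtain ⟨i, hi⟩ := h
      exact step ρ i hi (ih _ (lex_lt_of_descent hi))
    · push Not at h
      rw [eq_one_of_no_descent ρ fun i => (h i).not_gt]
      exact one

theorem adj_induction {n : ℕ} {p : Perm (Fin n) → Prop} (one : p 1)
    (mul : ∀ ρ i, p ρ → p (ρ * adj i)) (ρ : Perm (Fin n)) : p ρ :=
  descent_induction one (fun ρ i _ h => by simpa [mul_assoc] using mul _ i h) ρ

theorem adj_comm {n : ℕ} {i j : Fin (n - 1)} (h : 2 ≤ |((i : ℕ) : ℤ) - ((j : ℕ) : ℤ)|) :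
    adj i * adj j = adj j * adj i := by
  refine (Perm.disjoint_iff_disjoint_support.2 ?_).commute
  rw [adj, adj, Perm.support_swap (lo_ne_hi i), Perm.support_swap (lo_ne_hi j)]
  simp only [Finset.disjoint_left, Finset.mem_insert, Finset.mem_singleton, lo, hi, Fin.ext_iff]
  grind

theorem hi_eq_lo {n : ℕ} {i j : Fin (n - 1)} (h : (j : ℕ) = i + 1) : lo j = hi i := by
  simp [lo, hi, h]

theorem adj_braid {n : ℕ} {i j : Fin (n - 1)} (h : (j : ℕ) = i + 1) :
    adj i * adj j * adj i = adj j * adj i * adj j := by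
  have h1 : hi j ≠ lo i := by simp [lo, hi, Fin.ext_iff, h]; omega
  have h2 := (lo_ne_hi i)
  have h3 := (lo_ne_hi j)
  have h4 := hi_eq_lo h
  rw [adj, adj, h4]
  have e1 := swap_mul_swap_mul_swap (x := hi j) (y := hi i) (z := lo i) (by grind) (by grind)
  have e2 := swap_mul_swap_mul_swap (x := lo i) (y := hi i) (z := hi j) (by grind) (by grind)
  rw [swap_comm (hi i) (lo i), swap_comm (hi j) (hi i)] at e1
  rw [e1, e2, swap_comm]

/-! ### Homomorphisms out of the symmetric group from the Coxeter relations. -/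

section Lift

variable {n : ℕ} {M : Type*} [Monoid M]

open Classical in
/-- The product of the `v i` along a reduced word of a permutation. -/
def permLiftFun (v : Fin (n - 1) → M) (ρ : Perm (Fin n)) : M :=
  if h : ∃ i, ρ (hi i) < ρ (lo i) then permLiftFun v (ρ * adj h.choose) * v h.choose else 1
termination_by wellFounded_lt.wrap (toLex ⇑ρ)
decreasing_by exact lex_lt_of_descent h.choose_spec

/-- The Coxeter relations of the symmetric group. -/
structure CoxeterRel (v : Fin (n - 1) → M) : Prop where
  sq : ∀ i, v i * v i = 1
  far : ∀ i j : Fin (n - 1), 2 ≤ |((i : ℕ) : ℤ) - ((j : ℕ) : ℤ)| → v i * v j = v j * v i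
  braid : ∀ i j : Fin (n - 1), |((i : ℕ) : ℤ) - ((j : ℕ) : ℤ)| = 1 →
    v i * v j * v i = v j * v i * v j

theorem permLiftFun_one (v : Fin (n - 1) → M) : permLiftFun v 1 = 1 := by
  rw [permLiftFun, dif_neg]
  rintro ⟨i, h⟩
  exact (lo_lt_hi i).not_gt h

/-- The definition strips a chosen descent; the content here is that any descent gives the same
value. By induction, two descents are compared after stripping further to a common permutation: two
letters if they are far apart, three if they are neighbours. -/
theorem permLiftFun_of_descent {v : Fin (n - 1) → M} (hv : CoxeterRel v) (ρ : Perm (Fin n)) :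
    ∀ i, ρ (hi i) < ρ (lo i) → permLiftFun v ρ = permLiftFun v (ρ * adj i) * v i := by
  have wf : WellFounded fun ρ ρ' : Perm (Fin n) => toLex ⇑ρ < toLex ⇑ρ' :=
    InvImage.wf (fun ρ : Perm (Fin n) => toLex ⇑ρ) wellFounded_lt
  induction ρ using wf.induction with
  | _ ρ ih =>
    -- Two neighbouring descents mean three consecutive decreasing values. These can be sorted in
    -- two orders with three letters each, and the two words agree by the braid relation.
    have hnext : ∀ i j : Fin (n - 1), (j : ℕ) = i + 1 → ρ (hi i) < ρ (lo i) → ρ (hi j) < ρ (lo j) →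
        permLiftFun v (ρ * adj i) * v i = permLiftFun v (ρ * adj j) * v j := by
      intro i j hij hi' hj
      have h4 := hi_eq_lo hij
      have e1 : adj i (hi j) = hi j := adj_of_ne (by simp [lo, hi, hij]; omega) (by simp [hi, hij])
      have e2 : adj j (lo i) = lo i := adj_of_ne (by simp [lo, hij]) (by simp [lo, hi, hij]; omega)
      have e3 : adj j (hi i) = hi j := by rw [← h4, adj_lo]
      have e4 : adj i (lo j) = lo i := by rw [h4, adj_hi]
      have e5 : adj j (hi j) = hi i := by rw [← h4, adj_hi]
      have l1 := lex_lt_of_descent hi'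
      have l2 := lex_lt_of_descent hj
      rw [h4] at hj
      have d1 : (ρ * adj i) (hi j) < (ρ * adj i) (lo j) := by
        simpa [e1, e4] using hj.trans hi'
      have d2 : (ρ * adj i * adj j) (hi i) < (ρ * adj i * adj j) (lo i) := by
        simpa [e1, e2, e3] using hj
      have d3 : (ρ * adj j) (hi i) < (ρ * adj j) (lo i) := by
        simpa [e2, e3] using hj.trans hi'
      have d4 : (ρ * adj j * adj i) (hi j) < (ρ * adj j * adj i) (lo j) := by
        simpa [e1, e2, e3, e4, e5] using hi'
      rw [ih _ l1 j d1, ih _ ((lex_lt_of_descent d1).trans l1) i d2,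
        ih _ l2 i d3, ih _ ((lex_lt_of_descent d3).trans l2) j d4]
      have := hv.braid i j (by rw [hij]; push_cast; simp)
      simp only [mul_assoc] at this ⊢
      rw [this, show adj i * (adj j * adj i) = adj j * (adj i * adj j) by
        simpa [mul_assoc] using adj_braid hij]
    have key : ∀ i j, ρ (hi i) < ρ (lo i) → ρ (hi j) < ρ (lo j) →
        permLiftFun v (ρ * adj i) * v i = permLiftFun v (ρ * adj j) * v j := by
      intro i j hi' hj
      by_cases hij : i = j
      · rw [hij]
      by_cases h1 : (j : ℕ) = i + 1
      · exact hnext i j h1 hi' hj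
      by_cases h2 : (i : ℕ) = j + 1
      · exact (hnext j i h2 hj hi').symm
      have hfar : 2 ≤ |((i : ℕ) : ℤ) - ((j : ℕ) : ℤ)| := by grind
      have d1 : (ρ * adj i) (hi j) < (ρ * adj i) (lo j) := by
        simpa [adj_of_ne (i := i) (k := hi j) (by simp [lo, hi]; grind) (by simp [hi]; grind),
          adj_of_ne (i := i) (k := lo j) (by simp [lo]; grind) (by simp [lo, hi]; grind)] using hj
      have d2 : (ρ * adj j) (hi i) < (ρ * adj j) (lo i) := by
        simpa [adj_of_ne (i := j) (k := hi i) (by simp [lo, hi]; grind) (by simp [hi]; grind),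
          adj_of_ne (i := j) (k := lo i) (by simp [lo]; grind) (by simp [lo, hi]; grind)] using hi'
      rw [ih _ (lex_lt_of_descent hi') j d1, ih _ (lex_lt_of_descent hj) i d2, mul_assoc (permLiftFun v _),
        mul_assoc (permLiftFun v _), hv.far i j hfar, mul_assoc, mul_assoc, adj_comm hfar]
    intro i hi'
    have hex : ∃ i, ρ (hi i) < ρ (lo i) := ⟨i, hi'⟩
    rw [permLiftFun, dif_pos hex]
    exact key _ _ hex.choose_spec hi'

/-- Position `i` is a descent of exactly one of `ρ` and `ρ * adj i`; in the case of `ρ` the relation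
`v i * v i = 1` is used. -/
theorem permLiftFun_mul_adj {v : Fin (n - 1) → M} (hv : CoxeterRel v) (ρ : Perm (Fin n)) (i) :
    permLiftFun v (ρ * adj i) = permLiftFun v ρ * v i := by
  rcases lt_or_gt_of_ne (ρ.injective.ne (lo_ne_hi i)) with h | h
  · have := permLiftFun_of_descent hv (ρ * adj i) i (by simpa using h)
    rwa [mul_assoc, adj_mul_adj, mul_one] at this
  · rw [permLiftFun_of_descent hv ρ i h, mul_assoc, hv.sq, mul_one]

/-- The homomorphism from the symmetric group given by elements satisfying the Coxeter relations. -/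
def permLift (v : Fin (n - 1) → M) (hv : CoxeterRel v) : Perm (Fin n) →* M where
  toFun := permLiftFun v
  map_one' := permLiftFun_one v
  map_mul' ρ τ := by
    refine adj_induction (p := fun τ => permLiftFun v (ρ * τ) = permLiftFun v ρ * permLiftFun v τ)
      ?_ ?_ τ
    · rw [mul_one, permLiftFun_one, mul_one]
    · intro τ i h
      rw [← mul_assoc, permLiftFun_mul_adj hv, h, permLiftFun_mul_adj hv, mul_assoc]

@[simp] theorem permLift_adj (v : Fin (n - 1) → M) (hv : CoxeterRel v) (i) :
    permLift v hv (adj i) = v i := by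
  have := permLiftFun_mul_adj hv 1 i
  rwa [permLiftFun_one, one_mul, one_mul] at this

end Lift

/-! ### The shape of a tangle -/

theorem FlatTangle.eq_of_rel {n : ℕ} (T : FlatTangle n) {x y z} (hy : T.rel x y) (hz : T.rel x z)
    (h : y ≠ x) (h' : z ≠ x) : y = z :=
  (T.eq_partner h hy).trans (T.eq_partner h' hz).symm

theorem FlatTangle.ext_of_common {n : ℕ} {T T' : FlatTangle n}
    (h : ∀ x, ∃ y, y ≠ x ∧ T.rel x y ∧ T'.rel x y) : T = T' := by
  have hle : ∀ {T T' : FlatTangle n}, (∀ x, ∃ y, y ≠ x ∧ T.rel x y ∧ T'.rel x y) →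
      T.rel ≤ T'.rel := by
    intro T T' h x y hxy
    by_cases hne : y = x
    · subst hne; exact T'.rel.refl _
    · obtain ⟨z, hz, h1, h2⟩ := h x
      rwa [T.eq_of_rel hxy h1 hne hz]
  refine FlatTangle.ext (le_antisymm (hle h) (hle fun x => ?_))
  obtain ⟨y, h1, h2, h3⟩ := h x
  exact ⟨y, h1, h3, h2⟩

/-- The arcs of `T` join `(0, a)` to `(0, μ a)` and `(1, σ⁻¹ a)` to `(1, σ⁻¹ (μ a))` if `μ a ≠ a`,
and `(0, a)` to `(1, σ⁻¹ a)` if `μ a = a`. -/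
structure Shape {n : ℕ} (T : FlatTangle n) (μ σ : Perm (Fin n)) : Prop where
  top : ∀ a, T.rel (0, a) (0, μ a)
  bot : ∀ a, T.rel (1, σ⁻¹ a) (1, σ⁻¹ (μ a))
  thru : ∀ a, μ a = a → T.rel (0, a) (1, σ⁻¹ a)

namespace Shape

variable {n : ℕ} {T T' : FlatTangle n} {μ μ' σ σ' : Perm (Fin n)}

/-- If `μ` moves `a`, then both `a` and `μ (μ a)` are partners of `μ a` in row 0, and partners are
unique. -/
theorem invol (h : Shape T μ σ) (a : Fin n) : μ (μ a) = a := by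
  by_cases h1 : μ a = a
  · rw [h1, h1]
  · have := T.eq_of_rel (h.top (μ a)) (T.rel.symm (h.top a)) (by simpa using h1)
      (by simpa using Ne.symm h1)
    simpa using this

theorem ext (h : Shape T μ σ) (h' : Shape T' μ σ) : T = T' := by
  refine FlatTangle.ext_of_common ?_
  rintro ⟨r, a⟩
  fin_cases r
  · by_cases ha : μ a = a
    · exact ⟨(1, σ⁻¹ a), by simp, h.thru a ha, h'.thru a ha⟩
    · exact ⟨(0, μ a), by simpa using ha, h.top a, h'.top a⟩
  · obtain ⟨b, rfl⟩ := (σ⁻¹).surjective a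
    by_cases hb : μ b = b
    · exact ⟨(0, b), by simp, T.rel.symm (h.thru b hb), T'.rel.symm (h'.thru b hb)⟩
    · exact ⟨(1, σ⁻¹ (μ b)), by simpa using hb, h.bot b, h'.bot b⟩

/-- Such a `g` only permutes the arcs of `μ` and reverses some of them, which does not affect the
tangle. By `eq_of_fixed` and `comm_of_shape` this is the whole ambiguity of `σ`. -/
theorem twist (h : Shape T μ σ) (g : Perm (Fin n)) (hg : ∀ a, g (μ a) = μ (g a))
    (hfix : ∀ a, μ a = a → g a = a) : Shape T μ (g * σ) := by
  have hg' : ∀ a, g⁻¹ (μ a) = μ (g⁻¹ a) := fun a => by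
    rw [Perm.inv_eq_iff_eq, hg]; simp
  refine ⟨h.top, fun a => ?_, fun a ha => ?_⟩
  · have := h.bot (g⁻¹ a)
    rwa [← hg', ← Perm.mul_apply, ← Perm.mul_apply, ← mul_inv_rev] at this
  · have : g⁻¹ a = a := by rw [Perm.inv_eq_iff_eq, hfix a ha]
    rw [mul_inv_rev, Perm.mul_apply, this]
    exact h.thru a ha

theorem involution_unique (h : Shape T μ σ) (h' : Shape T μ' σ') : μ = μ' := by
  have aux : ∀ {μ μ' σ σ' : Perm (Fin n)}, Shape T μ σ → Shape T μ' σ' → ∀ a, μ a ≠ a →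
      μ' a = μ a := by
    intro μ μ' σ σ' h h' a ha
    by_cases ha' : μ' a = a
    · have := T.eq_of_rel (h.top a) (h'.thru a ha') (by simpa using ha) (by simp)
      simp at this
    · have := T.eq_of_rel (h'.top a) (h.top a) (by simpa using ha') (by simpa using ha)
      simpa using this
  ext a
  by_cases ha : μ a = a
  · by_cases ha' : μ' a = a
    · rw [ha, ha']
    · rw [aux h' h a ha']
  · rw [aux h h' a ha]

theorem eq_of_fixed (h : Shape T μ σ) (h' : Shape T μ σ') {a : Fin n} (ha : μ a = a) :
    (σ' * σ⁻¹) a = a := by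
  have := T.eq_of_rel (h.thru a ha) (h'.thru a ha) (by simp) (by simp)
  simp only [Prod.mk.injEq, true_and] at this
  rw [Perm.mul_apply, this]
  exact σ'.apply_symm_apply _

/-- Both `σ` and `σ'` carry the arcs of row 1 to the 2-cycles of `μ`, so `σ' * σ⁻¹` permutes these
2-cycles. -/
theorem comm_of_shape (h : Shape T μ σ) (h' : Shape T μ σ') (a : Fin n) :
    (σ' * σ⁻¹) (μ a) = μ ((σ' * σ⁻¹) a) := by
  by_cases ha : μ a = a
  · rw [ha, eq_of_fixed h h' ha, ha]
  · set g := σ' * σ⁻¹ with hg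
    -- If `g a` were fixed by `μ`, then `g` would fix `g a` and hence `a`, making `a` a fixed point
    -- of `μ`.
    have hga : μ (g a) ≠ g a := fun hc => by
      have h1 := eq_of_fixed h h' hc
      have h2 : g a = a := g.injective h1
      exact ha (by rwa [h2] at hc)
    have h1 : σ'⁻¹ (g a) = σ⁻¹ a := by simp [hg]
    have h2 := h'.bot (g a)
    rw [h1] at h2
    have h3 := T.eq_of_rel (h.bot a) h2 (by simpa using ha)
      (by rw [← h1]; simpa using hga)
    simp only [Prod.mk.injEq, true_and] at h3
    rw [hg, Perm.mul_apply, h3]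
    exact σ'.apply_symm_apply _

end Shape

theorem shape_id (n : ℕ) : Shape (.id n) 1 1 :=
  ⟨fun _ => Setoid.refl' _ _, fun _ => Setoid.refl' _ _, fun _ _ => (id_rel _ _).2 rfl⟩

theorem shape_v {n : ℕ} (i : Fin (n - 1)) : Shape (.v i) 1 (adj i) :=
  ⟨fun _ => Setoid.refl' _ _, fun _ => Setoid.refl' _ _, fun _ _ => Or.inr (by simp [adj])⟩

theorem shape_e {n : ℕ} (i : Fin (n - 1)) : Shape (.e i) (adj i) 1 := by
  have key : ∀ r a, (FlatTangle.e i).rel (r, a) (r, adj i a) := by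
    intro r a
    by_cases h : a = lo i
    · subst h
      exact Or.inr (by simp)
    · by_cases h' : a = hi i
      · subst h'
        exact Or.inr (by simp [h])
      · rw [adj_of_ne h h']
  refine ⟨key 0, key 1, fun a ha => Or.inr ?_⟩
  have h : a ≠ lo i := by
    rintro rfl; exact (lo_ne_hi i).symm (by simpa using ha)
  have h' : a ≠ hi i := by
    rintro rfl; exact (lo_ne_hi i) (by simpa using ha)
  simp [h, h']

/-! ### Concatenation on the left with the generators -/

/-- The curve of the concatenation through a point. -/
def curve {n : ℕ} (T T' : FlatTangle n) (r : Fin 3) (a : Fin n) : Quotient (stack T T') :=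
  Quotient.mk _ (r, a)

section Comp

variable {n : ℕ} {F T : FlatTangle n} {μ σ μ' σ' : Perm (Fin n)}

theorem curve_left {r s : Fin 2} {a b : Fin n} (h : F.rel (r, a) (s, b)) :
    curve F T (![0, 1] r) a = curve F T (![0, 1] s) b :=
  Quotient.sound ((le_sup_left : _ ≤ stack F T) (map_rel F.rel (rows ![0, 1]) h))

theorem curve_right {r s : Fin 2} {a b : Fin n} (h : T.rel (r, a) (s, b)) :
    curve F T (![1, 2] r) a = curve F T (![1, 2] s) b :=
  Quotient.sound ((le_sup_right : _ ≤ stack F T) (map_rel T.rel (rows ![1, 2]) h))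

/-- Connectedness is expressed as equality in the quotient by curves, so that tracing a strand
through the diagram becomes equational reasoning. -/
theorem shape_comp (top : ∀ a, curve F T 0 a = curve F T 0 (μ' a))
    (bot : ∀ a, curve F T 2 (σ'⁻¹ a) = curve F T 2 (σ'⁻¹ (μ' a)))
    (thru : ∀ a, μ' a = a → curve F T 0 a = curve F T 2 (σ'⁻¹ a)) : Shape (F.comp T) μ' σ' :=
  have key : ∀ {r s : Fin 2} {a b : Fin n}, curve F T (![0, 2] r) a = curve F T (![0, 2] s) b →
      (F.comp T).rel (r, a) (s, b) := fun h => Quotient.exact (s := stack F T) h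
  ⟨fun a => key (top a), fun a => key (bot a), fun a ha => key (thru a ha)⟩

theorem loops_eq_zero_of_curve
    (h : ∀ a, ∃ b, curve F T 1 a = curve F T 0 b ∨ curve F T 1 a = curve F T 2 b) :
    loops F T = 0 := by
  refine loops_eq_zero fun a => ?_
  obtain ⟨b, h | h⟩ := h a
  · exact ⟨(0, b), by simp, Quotient.exact h.symm⟩
  · exact ⟨(2, b), by simp, Quotient.exact h.symm⟩

theorem curve_v {i : Fin (n - 1)} (a : Fin n) :
    curve (.v i) T 0 a = curve (.v i) T 1 (adj i a) := by
  simpa using curve_left (T := T) ((shape_v i).thru a rfl)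

theorem loops_v (i : Fin (n - 1)) : loops (.v i) T = 0 :=
  loops_eq_zero_of_curve fun a => ⟨adj i a, Or.inl (by
    rw [curve_v, ← Perm.mul_apply, adj_mul_adj, Perm.one_apply])⟩

/-- The crossing renames the upper ends by `adj i` and leaves row 1 alone; `adj i * σ` compensates
for the renaming on the lower side. -/
theorem Shape.v_comp (h : Shape T μ σ) (i : Fin (n - 1)) :
    Shape ((FlatTangle.v i).comp T) (adj i * μ * adj i) (adj i * σ) := by
  have hs : ∀ a, adj i (adj i a) = a := fun a => by
    rw [← Perm.mul_apply, adj_mul_adj, Perm.one_apply]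
  refine shape_comp (fun a => ?_) (fun a => ?_) (fun a ha => ?_)
  · rw [curve_v, curve_v]
    simpa [hs] using curve_right (h.top (adj i a))
  · simpa [hs] using curve_right (h.bot (adj i a))
  · rw [curve_v]
    have := h.thru (adj i a) (by rw [← hs (μ (adj i a))]; exact congrArg _ ha)
    simpa [hs] using curve_right this

end Comp

/-! ### Concatenation with a cap: four cases according to the strands of the second tangle at its
two ends. -/

section Cap

variable {n : ℕ} {F T : FlatTangle n} {μ σ : Perm (Fin n)} {a b : Fin n}

/-- All identifications between the three rows that the case analysis needs. The ends `a`, `b` are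
arbitrary so that their roles can be exchanged. -/
theorem Shape.cap_curves (hF : Shape F (swap a b) 1) (hT : Shape T μ σ) :
    curve F T 0 a = curve F T 0 b ∧ curve F T 1 a = curve F T 1 b ∧
    (∀ k, k ≠ a → k ≠ b → curve F T 0 k = curve F T 1 k) ∧
    (∀ k, curve F T 1 (μ k) = curve F T 1 k) ∧
    (∀ k, curve F T 2 (σ⁻¹ (μ k)) = curve F T 2 (σ⁻¹ k)) ∧
    (∀ k, μ k = k → curve F T 2 (σ⁻¹ k) = curve F T 1 k) := by
  refine ⟨?_, ?_, fun k h h' => ?_, fun k => ?_, fun k => ?_, fun k hk => ?_⟩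
  · simpa using curve_left (T := T) (hF.top a)
  · simpa using curve_left (T := T) (hF.bot a)
  · simpa using curve_left (T := T) (hF.thru k (swap_apply_of_ne_of_ne h h'))
  · simpa using (curve_right (F := F) (hT.top k)).symm
  · simpa using (curve_right (F := F) (hT.bot k)).symm
  · simpa using (curve_right (F := F) (hT.thru k hk)).symm

theorem Shape.cap_comp_arc (hF : Shape F (swap a b) 1) (hT : Shape T μ σ) (hab : a ≠ b)
    (h : μ a = b) : Shape (F.comp T) μ σ := by
  obtain ⟨h1, h2, h3, h4, h5, h6⟩ := hF.cap_curves hT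
  have hi := hT.invol
  refine shape_comp (fun x => ?_) (fun x => (h5 x).symm) (fun x hx => ?_)
  · grind
  · grind

/-- Two through strands meet the cap: their upper halves are replaced by the arc from `a` to `b`,
and their lower ends become joined. -/
theorem Shape.cap_comp_free (hF : Shape F (swap a b) 1) (hT : Shape T μ σ) (hab : a ≠ b)
    (ha : μ a = a) (hb : μ b = b) : Shape (F.comp T) (swap a b * μ) σ := by
  obtain ⟨h1, h2, h3, h4, h5, h6⟩ := hF.cap_curves hT
  have hi := hT.invol
  refine shape_comp (fun x => ?_) (fun x => ?_) (fun x hx => ?_)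
  all_goals simp only [Perm.mul_apply, swap_apply_def] at *; grind

/-- The through strand at `a` continues along the cap to `b` and then along the arc to `c`. So `c`
becomes the upper end of a strand that ends where that of `a` ended, which is what `swap a c`
records. -/
theorem Shape.cap_comp_mixed (hF : Shape F (swap a b) 1) (hT : Shape T μ σ) (hab : a ≠ b)
    {c : Fin n} (ha : μ a = a) (hb : μ b = c) (hbc : b ≠ c) :
    Shape (F.comp T) (swap a b * (swap b c * μ)) (swap a c * σ) := by
  obtain ⟨h1, h2, h3, h4, h5, h6⟩ := hF.cap_curves hT
  have hi := hT.invol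
  have hc : μ c = b := by rw [← hb, hi]
  refine shape_comp (fun x => ?_) (fun x => ?_) (fun x hx => ?_)
  all_goals simp only [Perm.mul_apply, swap_apply_def, mul_inv_rev, swap_inv] at *; grind

/-- The arcs from `a` to `c` and from `b` to `d` are linked by the cap into one from `c` to `d`,
beside the new arc from `a` to `b`. Row 1 keeps its arcs, but these now have to correspond to the
pairs `a, b` and `c, d`; hence `swap b c`. -/
theorem Shape.cap_comp_two_arcs (hF : Shape F (swap a b) 1) (hT : Shape T μ σ) (hab : a ≠ b)
    {c d : Fin n} (ha : μ a = c) (hb : μ b = d) (hac : a ≠ c) (hbd : b ≠ d) (had : a ≠ d) :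
    Shape (F.comp T) (swap a b * (swap c d * (swap b d * (swap a c * μ)))) (swap b c * σ) := by
  obtain ⟨h1, h2, h3, h4, h5, h6⟩ := hF.cap_curves hT
  have hi := hT.invol
  have hc : μ c = a := by rw [← ha, hi]
  have hd : μ d = b := by rw [← hb, hi]
  refine shape_comp (fun x => ?_) (fun x => ?_) (fun x hx => ?_)
  all_goals simp only [Perm.mul_apply, swap_apply_def, mul_inv_rev, swap_inv] at *; grind

/-- Away from `a` and `b` the cap connects row 1 straight to row 0. The curve through `a` and `b`
leaves the middle row either down the through strand at `a` or up at `μ a`. -/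
theorem Shape.loops_cap (hF : Shape F (swap a b) 1) (hT : Shape T μ σ)
    (h : μ a ≠ b) : loops F T = 0 := by
  obtain ⟨h1, h2, h3, h4, h5, h6⟩ := hF.cap_curves hT
  have hi := hT.invol
  refine loops_eq_zero_of_curve fun x => ?_
  by_cases hx : x = a ∨ x = b
  · have hxa : curve F T 1 x = curve F T 1 a := by
      rcases hx with rfl | rfl
      · rfl
      · exact h2.symm
    by_cases ha : μ a = a
    · exact ⟨σ⁻¹ a, Or.inr (by rw [hxa, h6 a ha])⟩
    · exact ⟨μ a, Or.inl (by rw [hxa, h3 _ ha h, h4])⟩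
  · push Not at hx
    exact ⟨x, Or.inl (h3 x hx.1 hx.2).symm⟩

theorem Shape.loops_cap_arc (hF : Shape F (swap a b) 1) (hT : Shape T μ σ) (hab : a ≠ b)
    (h : μ a = b) : loops F T = 1 := by
  have hi := hT.invol
  have hcl : ∀ x, stack F T (1, a) x ↔ x = (1, a) ∨ x = (1, b) := by
    intro x
    constructor
    -- Being one of the two points `(1, a)`, `(1, b)` is invariant along the arcs of each factor,
    -- since both factors pair these points; so they form a full class.
    · have hle : stack F T ≤ Setoid.ker (fun x => x = ((1, a) : Fin 3 × Fin n) ∨ x = (1, b)) := by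
        have aux : ∀ (T : FlatTangle n) (e : Fin 2 → Fin 3) (he : Function.Injective e) (r : Fin 2),
            e r = 1 → T.rel (r, a) (r, b) → T.rel.map (rows e) ≤
              Setoid.ker (fun x => x = ((1, a) : Fin 3 × Fin n) ∨ x = (1, b)) := by
          intro T e he r her hr
          rw [map_le_iff]
          have key : ∀ x y, T.rel x y → (rows e x = (1, a) ∨ rows e x = (1, b)) →
              (rows e y = (1, a) ∨ rows e y = (1, b)) := by
            intro x y hxy hx
            have e1 : ∀ k : Fin n, rows e (r, k) = (1, k) := fun k => by simp [rows, her]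
            rw [← e1, ← e1, (rows_injective he).eq_iff, (rows_injective he).eq_iff] at hx ⊢
            by_cases hne : y = x
            · rwa [hne]
            rcases hx with rfl | rfl
            · exact Or.inr (T.eq_of_rel hxy hr hne (by simpa using hab.symm))
            · exact Or.inl (T.eq_of_rel hxy (T.rel.symm hr) hne (by simpa using hab))
          exact fun x y hxy => propext ⟨key x y hxy, key y x (T.rel.symm hxy)⟩
        refine sup_le (aux F _ (by decide) 1 rfl ?_) (aux T _ (by decide) 0 rfl ?_)
        · simpa using hF.bot a
        · simpa [h] using hT.top a
      intro hx
      exact (hle hx).mp (Or.inl rfl)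
    · rintro (rfl | rfl)
      · exact Setoid.refl' _ _
      · exact Quotient.exact (hF.cap_curves hT).2.1
  obtain ⟨h1, h2, h3, h4, h5, h6⟩ := hF.cap_curves hT
  rw [loops, Set.ncard_eq_one]
  refine ⟨{x | stack F T x (1, a)}, ?_⟩
  ext C
  simp only [Set.mem_ofPred_eq, Set.mem_singleton_iff]
  constructor
  · rintro ⟨⟨⟨r, x⟩, rfl⟩, hC⟩
    have hr : r = 1 := hC (r, x) ((stack F T).refl' _)
    subst hr
    have hx : x = a ∨ x = b := by
      by_contra hx
      push Not at hx
      have := hC (0, x) (Quotient.exact (h3 x hx.1 hx.2))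
      simp at this
    have : stack F T (1, x) (1, a) :=
      Setoid.symm' _ ((hcl _).2 (by rcases hx with rfl | rfl <;> simp))
    ext y
    exact ⟨fun hy => Setoid.trans' _ hy this, fun hy => Setoid.trans' _ hy (Setoid.symm' _ this)⟩
  · rintro rfl
    refine ⟨⟨_, rfl⟩, fun p hp => ?_⟩
    rcases (hcl p).1 (Setoid.symm' _ hp) with rfl | rfl <;> rfl

end Cap

/-! ### Every tangle has a shape -/

namespace FlatTangle

variable {n : ℕ} (T : FlatTangle n)

/-- The involution of the columns given by the arcs with both ends in the row `r`. -/
def rowPerm (r : Fin 2) : Perm (Fin n) :=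
  Function.Involutive.toPerm
    (fun a => if (T.partner (r, a)).1 = r then (T.partner (r, a)).2 else a) (by
      intro a
      by_cases h : (T.partner (r, a)).1 = r
      · have h1 : (r, (T.partner (r, a)).2) = T.partner (r, a) := Prod.ext h.symm rfl
        simp only [if_pos h, h1, T.partner_partner, if_true]
      · simp only [if_neg h])

theorem rowPerm_apply (r : Fin 2) (a : Fin n) : T.rowPerm r a =
    if (T.partner (r, a)).1 = r then (T.partner (r, a)).2 else a := rfl

theorem rowPerm_eq_self_iff (r : Fin 2) (a : Fin n) :
    T.rowPerm r a = a ↔ (T.partner (r, a)).1 ≠ r := by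
  rw [rowPerm_apply]
  by_cases h : (T.partner (r, a)).1 = r
  · simp only [ne_eq, h, not_true_eq_false, iff_false]
    exact fun h' => T.partner_ne (r, a) (Prod.ext h h')
  · simp [h]

theorem rowPerm_rel (r : Fin 2) (a : Fin n) : T.rel (r, a) (r, T.rowPerm r a) := by
  rw [rowPerm_apply]
  by_cases h : (T.partner (r, a)).1 = r
  · rw [if_pos h]
    convert T.rel_partner (r, a) using 1
    exact Prod.ext h.symm rfl
  · rw [if_neg h]

theorem partner_of_fixed {r s : Fin 2} (hrs : s ≠ r) {a : Fin n} (h : T.rowPerm r a = a) :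
    T.partner (r, a) = (s, (T.partner (r, a)).2) := by
  rw [rowPerm_eq_self_iff] at h
  exact Prod.ext (show (T.partner (r, a)).1 = s by omega) rfl

theorem rowPerm_partner {r s : Fin 2} (hrs : s ≠ r) {a : Fin n} (h : T.rowPerm r a = a) :
    T.rowPerm s (T.partner (r, a)).2 = (T.partner (r, a)).2 := by
  rw [rowPerm_eq_self_iff, ← T.partner_of_fixed hrs h, T.partner_partner]
  exact hrs.symm

/-- The bijection between the columns of the lower and the upper ends of the through strands. -/
def throughEquiv : {a // T.rowPerm 1 a = a} ≃ {a // T.rowPerm 0 a = a} where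
  toFun a := ⟨(T.partner (1, a.1)).2, T.rowPerm_partner (by decide) a.2⟩
  invFun a := ⟨(T.partner (0, a.1)).2, T.rowPerm_partner (by decide) a.2⟩
  left_inv a := Subtype.ext (by
    simp only
    rw [← T.partner_of_fixed (by decide) a.2, T.partner_partner])
  right_inv a := Subtype.ext (by
    simp only
    rw [← T.partner_of_fixed (by decide) a.2, T.partner_partner])

theorem rowPerm_sq (r : Fin 2) : T.rowPerm r ^ 2 = 1 := by
  rw [pow_two]
  exact Equiv.ext fun a => Function.Involutive.toPerm_involutive _ a

/-- Through strands match the fixed points in the two rows, so both involutions have the same number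
of fixed points. All their cycles have length 2, so the cycle types agree. -/
theorem isConj_rowPerm : IsConj (T.rowPerm 1) (T.rowPerm 0) := by
  have hcard : (T.rowPerm 1).support.card = (T.rowPerm 0).support.card := by
    have h := Fintype.card_congr T.throughEquiv
    have h0 : ∀ r, (T.rowPerm r).support.card + Fintype.card {a // T.rowPerm r a = a} = n := by
      intro r
      rw [Fintype.card_subtype, show (T.rowPerm r).support =
        Finset.univ.filter (fun a => ¬ T.rowPerm r a = a) from rfl, add_comm,
        Finset.card_filter_add_card_filter_not, Finset.card_univ, Fintype.card_fin]
    have h1 := h0 1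
    have h2 := h0 0
    omega
  rw [Perm.isConj_iff_cycleType_eq]
  have h0 : ∀ r, (T.rowPerm r).cycleType =
      Multiset.replicate (T.rowPerm r).cycleType.card 2 := fun r =>
    Perm.cycleType_of_pow_prime_eq_one (T.rowPerm_sq r)
  have h1 : ∀ r, (T.rowPerm r).support.card = (T.rowPerm r).cycleType.card * 2 := fun r => by
    rw [← Perm.sum_cycleType]
    conv_lhs => rw [h0 r]
    simp
  rw [h0 1, h0 0]
  congr 1
  have := h1 1
  have := h1 0
  omega

theorem exists_shape : ∃ μ σ, Shape T μ σ := by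
  obtain ⟨c, hc⟩ := isConj_iff.1 T.isConj_rowPerm
  have hc' : ∀ b, c (T.rowPerm 1 b) = T.rowPerm 0 (c b) := fun b => by
    rw [← hc]; simp
  -- The permutation `σ` is glued from the through strands on the fixed points and from a
  -- conjugating permutation on the points of arcs.
  let f : {a // ¬ T.rowPerm 1 a = a} ≃ {a // ¬ T.rowPerm 0 a = a} :=
    c.subtypeEquiv fun a => by rw [← hc', c.injective.eq_iff]
  let σ : Perm (Fin n) := subtypeCongr T.throughEquiv f
  have hfix : ∀ b, T.rowPerm 1 b = b → σ b = (T.partner (1, b)).2 := fun b hb => by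
    change sumCompl _ (Sum.map _ _ ((sumCompl fun b => T.rowPerm 1 b = b).symm b)) = _
    rw [sumCompl_symm_apply_of_pos (p := fun b => T.rowPerm 1 b = b) hb]
    rfl
  have hmov : ∀ b, ¬ T.rowPerm 1 b = b → σ b = c b := fun b hb => by
    change sumCompl _ (Sum.map _ _ ((sumCompl fun b => T.rowPerm 1 b = b).symm b)) = _
    rw [sumCompl_symm_apply_of_neg (p := fun b => T.rowPerm 1 b = b) hb]
    rfl
  have hcomm : ∀ b, σ (T.rowPerm 1 b) = T.rowPerm 0 (σ b) := by
    intro b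
    by_cases hb : T.rowPerm 1 b = b
    · rw [hb, hfix b hb, T.rowPerm_partner (by decide) hb]
    · rw [hmov b hb, hmov _ (fun h => hb ((T.rowPerm 1).injective h)), hc']
  refine ⟨T.rowPerm 0, σ, T.rowPerm_rel 0, fun a => ?_, fun a ha => ?_⟩
  · obtain ⟨b, rfl⟩ := σ.surjective a
    rw [← hcomm]
    simpa using T.rowPerm_rel 1 b
  · obtain ⟨b, rfl⟩ := σ.surjective a
    rw [← hcomm, σ.injective.eq_iff] at ha
    have h1 := T.partner_of_fixed (s := 0) (by decide) ha
    rw [← hfix b ha] at h1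
    have := T.rel.symm (T.rel_partner (1, b))
    rw [h1] at this
    simpa using this

end FlatTangle

/-! ### The relations hold in the algebra of tangles -/

section Relations

variable {n : ℕ} {T : FlatTangle n} {μ σ : Perm (Fin n)}

theorem of_v_mul_of (i : Fin (n - 1)) (T : FlatTangle n) :
    VTL.of (.v i) * VTL.of T = VTL.of ((FlatTangle.v i).comp T) := by
  rw [VTL.of_mul_of, loops_v, pow_zero, one_smul]

theorem Shape.of_e_mul_of (h : Shape T μ σ) {i : Fin (n - 1)} (hne : μ (lo i) ≠ hi i) :
    VTL.of (.e i) * VTL.of T = VTL.of ((FlatTangle.e i).comp T) := by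
  rw [VTL.of_mul_of, (shape_e i).loops_cap h hne, pow_zero, one_smul]

theorem Shape.of_e_mul_of_arc (h : Shape T μ σ) {i : Fin (n - 1)} (he : μ (lo i) = hi i) :
    VTL.of (.e i) * VTL.of T = (X : ℤ[X]) • VTL.of T := by
  rw [VTL.of_mul_of, (shape_e i).loops_cap_arc h (lo_ne_hi i) he, pow_one,
    ((shape_e i).cap_comp_arc h (lo_ne_hi i) he).ext h]

theorem adj_far {i j : Fin (n - 1)} (h : 2 ≤ |((i : ℕ) : ℤ) - ((j : ℕ) : ℤ)|) :
    adj j (lo i) = lo i ∧ adj j (hi i) = hi i :=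
  ⟨adj_of_ne (by simp [lo]; grind) (by simp [lo, hi]; grind),
    adj_of_ne (by simp [lo, hi]; grind) (by simp [hi]; grind)⟩

theorem abs_sub_eq_one_iff {i j : Fin (n - 1)} :
    |((i : ℕ) : ℤ) - ((j : ℕ) : ℤ)| = 1 ↔ (j : ℕ) = i + 1 ∨ (i : ℕ) = j + 1 := by
  grind

/-- Reversing the arc of `E_i` gives it a second shape, which is the one produced by `E_i v_i` and
by `v_i E_i`. -/
theorem shape_e_twist (i : Fin (n - 1)) : Shape (.e i) (adj i) (adj i) := by
  simpa using (shape_e i).twist (adj i) (fun a => rfl) (fun a ha => ha)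

theorem e_mul_e (i : Fin (n - 1)) :
    VTL.of (.e i) * VTL.of (.e i) = (X : ℤ[X]) • VTL.of (.e i) :=
  (shape_e i).of_e_mul_of_arc (adj_lo i)

theorem v_mul_v (i : Fin (n - 1)) : VTL.of (.v i) * VTL.of (.v i) = 1 := by
  rw [of_v_mul_of]
  refine congrArg VTL.of (Shape.ext ?_ (shape_id n))
  simpa using (shape_v i).v_comp i

theorem e_mul_v (i : Fin (n - 1)) : VTL.of (.e i) * VTL.of (.v i) = VTL.of (.e i) := by
  rw [(shape_v i).of_e_mul_of (lo_ne_hi i)]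
  refine congrArg VTL.of (Shape.ext ?_ (shape_e_twist i))
  simpa [adj] using (shape_e i).cap_comp_free (shape_v i) (lo_ne_hi i) rfl rfl

theorem v_mul_e (i : Fin (n - 1)) : VTL.of (.v i) * VTL.of (.e i) = VTL.of (.e i) := by
  rw [of_v_mul_of]
  refine congrArg VTL.of (Shape.ext ?_ (shape_e_twist i))
  simpa using (shape_e i).v_comp i

theorem e_mul_e_far {i j : Fin (n - 1)} (h : 2 ≤ |((i : ℕ) : ℤ) - ((j : ℕ) : ℤ)|) :
    VTL.of (.e i) * VTL.of (.e j) = VTL.of (.e j) * VTL.of (.e i) := by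
  have h1 : 2 ≤ |((j : ℕ) : ℤ) - ((i : ℕ) : ℤ)| := by rwa [abs_sub_comm]
  have h2 := adj_far h
  have h3 := adj_far h1
  rw [(shape_e j).of_e_mul_of (by rw [h2.1]; exact lo_ne_hi i),
    (shape_e i).of_e_mul_of (by rw [h3.1]; exact lo_ne_hi j)]
  refine congrArg VTL.of (Shape.ext
    ((shape_e i).cap_comp_free (shape_e j) (lo_ne_hi i) h2.1 h2.2) ?_)
  have := (shape_e j).cap_comp_free (shape_e i) (lo_ne_hi j) h3.1 h3.2
  rwa [← adj, ← adj_comm h] at this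

theorem v_mul_v_far {i j : Fin (n - 1)} (h : 2 ≤ |((i : ℕ) : ℤ) - ((j : ℕ) : ℤ)|) :
    VTL.of (.v i) * VTL.of (.v j) = VTL.of (.v j) * VTL.of (.v i) := by
  rw [of_v_mul_of, of_v_mul_of]
  refine congrArg VTL.of (Shape.ext ((shape_v j).v_comp i) ?_)
  simpa [adj_comm h] using (shape_v i).v_comp j

theorem v_mul_e_far {i j : Fin (n - 1)} (h : 2 ≤ |((i : ℕ) : ℤ) - ((j : ℕ) : ℤ)|) :
    VTL.of (.v i) * VTL.of (.e j) = VTL.of (.e j) * VTL.of (.v i) := by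
  rw [of_v_mul_of, (shape_v i).of_e_mul_of (lo_ne_hi j)]
  refine congrArg VTL.of (Shape.ext ((shape_e j).v_comp i) ?_)
  have := (shape_e j).cap_comp_free (shape_v i) (lo_ne_hi j) rfl rfl
  rw [← adj] at this
  rwa [adj_comm h, mul_assoc, adj_mul_adj, mul_one]

/-- Here `x` is the point common to the two neighbouring pairs, so `j = i + 1` and `i = j + 1` can
be treated together. -/
theorem exists_swap_of_near {i j : Fin (n - 1)} (h : |((i : ℕ) : ℤ) - ((j : ℕ) : ℤ)| = 1) :
    ∃ x y z, x ≠ y ∧ x ≠ z ∧ y ≠ z ∧ (lo i = x ∧ hi i = y ∨ lo i = y ∧ hi i = x) ∧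
      adj i = swap x y ∧ adj j = swap x z := by
  rcases abs_sub_eq_one_iff.1 h with h | h
  · have h4 := hi_eq_lo h
    refine ⟨hi i, lo i, hi j, (lo_ne_hi i).symm, ?_, ?_, Or.inr ⟨rfl, rfl⟩, swap_comm _ _, ?_⟩
    · rw [← h4]; exact lo_ne_hi j
    · simp [lo, hi, h]; omega
    · rw [adj, h4]
  · have h4 := hi_eq_lo h
    refine ⟨lo i, hi i, lo j, lo_ne_hi i, ?_, ?_, Or.inl ⟨rfl, rfl⟩, rfl, ?_⟩
    · rw [h4]; exact (lo_ne_hi j).symm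
    · simp [lo, hi, h]; omega
    · rw [adj, h4, swap_comm]

theorem adj_braid' {i j : Fin (n - 1)} (h : |((i : ℕ) : ℤ) - ((j : ℕ) : ℤ)| = 1) :
    adj i * adj j * adj i = adj j * adj i * adj j := by
  rcases abs_sub_eq_one_iff.1 h with h | h
  · exact adj_braid h
  · exact (adj_braid h).symm

theorem e_mul_v_mul_e {i j : Fin (n - 1)} (h : |((i : ℕ) : ℤ) - ((j : ℕ) : ℤ)| = 1) :
    VTL.of (.e i) * VTL.of (.v j) * VTL.of (.e i) = VTL.of (.e i) := by
  obtain ⟨x, y, z, hxy, hxz, hyz, hl, hi', hj⟩ := exists_swap_of_near h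
  have hs := (shape_e i).v_comp j
  have he := shape_e i
  rw [hi', hj, swap_comm x y, swap_mul_swap_mul_swap hxy.symm hyz, mul_one] at hs
  rw [hi'] at he
  rw [mul_assoc, of_v_mul_of, hs.of_e_mul_of (by simp only [swap_apply_def]; grind)]
  refine congrArg VTL.of (Shape.ext ?_ he)
  -- In `v_j E_i` the upper arc joins `y` and `z` while `x` carries a through strand. The mixed case
  -- applies, and its factor `swap x z` cancels the one from `v_j`.
  have := he.cap_comp_mixed hs hxy (c := z) (swap_apply_of_ne_of_ne hxz hxy)
    (swap_apply_right _ _) hyz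
  simpa [swap_comm z y] using this

theorem v_mul_v_mul_v {i j : Fin (n - 1)} (h : |((i : ℕ) : ℤ) - ((j : ℕ) : ℤ)| = 1) :
    VTL.of (.v i) * VTL.of (.v j) * VTL.of (.v i) =
      VTL.of (.v j) * VTL.of (.v i) * VTL.of (.v j) := by
  rw [mul_assoc, mul_assoc, of_v_mul_of, of_v_mul_of, of_v_mul_of, of_v_mul_of]
  refine congrArg VTL.of (Shape.ext (((shape_v i).v_comp j).v_comp i) ?_)
  have := ((shape_v j).v_comp i).v_comp j
  simp only [mul_one, adj_mul_adj, ← mul_assoc] at this ⊢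
  rwa [adj_braid' h]

theorem v_mul_v_mul_e {i j : Fin (n - 1)} (h : |((i : ℕ) : ℤ) - ((j : ℕ) : ℤ)| = 1) :
    VTL.of (.v i) * VTL.of (.v j) * VTL.of (.e i) =
      VTL.of (.e j) * VTL.of (.v i) * VTL.of (.v j) := by
  have hs := (shape_v j).v_comp i
  rw [mul_one, adj_mul_adj] at hs
  rw [mul_assoc, mul_assoc, of_v_mul_of, of_v_mul_of, of_v_mul_of, hs.of_e_mul_of (lo_ne_hi j)]
  refine congrArg VTL.of (Shape.ext (((shape_e i).v_comp j).v_comp i) ?_)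
  have := (shape_e j).cap_comp_free hs (lo_ne_hi j) rfl rfl
  rw [← adj, mul_one] at this
  have hconj : adj i * (adj j * adj i * adj j) * adj i = adj j := by
    rw [← adj_braid' h, mul_assoc, mul_assoc, adj_mul_adj, mul_one, ← mul_assoc, adj_mul_adj,
      one_mul]
  rwa [hconj, mul_one]

/-- The tangle of the same name as a generator. -/
def Gen.tangle : Gen n → FlatTangle n
  | .E i => .e i
  | .v i => .v i

theorem lift_rel ⦃x y : FreeAlgebra ℤ[X] (Gen n)⦄ (h : Rel n x y) :
    FreeAlgebra.lift ℤ[X] (fun g : Gen n => VTL.of g.tangle) x =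
      FreeAlgebra.lift ℤ[X] (fun g : Gen n => VTL.of g.tangle) y := by
  cases h <;> simp only [map_mul, map_smul, map_one, FreeAlgebra.lift_ι_apply, Gen.tangle]
  · exact e_mul_e _
  · exact v_mul_v _
  · exact e_mul_v _
  · exact v_mul_e _
  · exact e_mul_e_far ‹_›
  · exact v_mul_v_far ‹_›
  · exact v_mul_e_far ‹_›
  · exact e_mul_v_mul_e ‹_›
  · exact v_mul_v_mul_v ‹_›
  · exact v_mul_v_mul_e ‹_›

/-- The homomorphism from the presented algebra that sends each generator to the tangle of the
same name. -/
def toVTL (n : ℕ) : Presented n →ₐ[ℤ[X]] VTL n :=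
  RingQuot.liftAlgHom ℤ[X] ⟨FreeAlgebra.lift ℤ[X] fun g : Gen n => VTL.of g.tangle, lift_rel⟩

@[simp] theorem toVTL_gen (g : Gen n) : toVTL n (.gen g) = VTL.of g.tangle := by
  rw [toVTL, Presented.gen, RingQuot.liftAlgHom_mkAlgHom_apply, FreeAlgebra.lift_ι_apply]

end Relations

/-! ### Arcs in the presented algebra -/

namespace Presented

variable {n : ℕ}

/-- The generator `E_i` of the presented algebra. -/
abbrev pE (i : Fin (n - 1)) : Presented n := gen (.E i)

/-- The generator `v_i` of the presented algebra. -/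
abbrev pv (i : Fin (n - 1)) : Presented n := gen (.v i)

theorem pE_mul_pE (i : Fin (n - 1)) : pE i * pE i = (X : ℤ[X]) • pE i := by
  simpa [gen] using RingQuot.mkAlgHom_rel ℤ[X] (Rel.E_sq i)

theorem pE_mul_pv (i : Fin (n - 1)) : pE i * pv i = pE i := by
  simpa [gen] using RingQuot.mkAlgHom_rel ℤ[X] (Rel.E_v i)

theorem pv_mul_pE (i : Fin (n - 1)) : pv i * pE i = pE i := by
  simpa [gen] using RingQuot.mkAlgHom_rel ℤ[X] (Rel.v_E i)

theorem pE_mul_pE_far {i j : Fin (n - 1)} (h : 2 ≤ |((i : ℕ) : ℤ) - ((j : ℕ) : ℤ)|) :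
    pE i * pE j = pE j * pE i := by
  simpa [gen] using RingQuot.mkAlgHom_rel ℤ[X] (Rel.E_E_far i j h)

theorem pv_mul_pE_far {i j : Fin (n - 1)} (h : 2 ≤ |((i : ℕ) : ℤ) - ((j : ℕ) : ℤ)|) :
    pv i * pE j = pE j * pv i := by
  simpa [gen] using RingQuot.mkAlgHom_rel ℤ[X] (Rel.v_E_far i j h)

theorem pE_mul_pv_mul_pE {i j : Fin (n - 1)} (h : |((i : ℕ) : ℤ) - ((j : ℕ) : ℤ)| = 1) :
    pE i * pv j * pE i = pE i := by
  simpa [gen] using RingQuot.mkAlgHom_rel ℤ[X] (Rel.E_v_E i j h)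

theorem pv_mul_pv_mul_pE {i j : Fin (n - 1)} (h : |((i : ℕ) : ℤ) - ((j : ℕ) : ℤ)| = 1) :
    pv i * pv j * pE i = pE j * pv i * pv j := by
  simpa [gen] using RingQuot.mkAlgHom_rel ℤ[X] (Rel.v_v_E i j h)

theorem coxeterRel_pv : CoxeterRel (pv : Fin (n - 1) → Presented n) where
  sq i := by simpa [gen] using RingQuot.mkAlgHom_rel ℤ[X] (Rel.v_sq i)
  far i j h := by simpa [gen] using RingQuot.mkAlgHom_rel ℤ[X] (Rel.v_v_far i j h)
  braid i j h := by simpa [gen] using RingQuot.mkAlgHom_rel ℤ[X] (Rel.v_v_v i j h)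

/-- The homomorphism from the symmetric group that sends adjacent transpositions to the `v_i`. -/
def perm : Perm (Fin n) →* Presented n := permLift pv coxeterRel_pv

@[simp] theorem perm_adj (i : Fin (n - 1)) : perm (adj i) = pv i := permLift_adj _ _ _

theorem perm_mul_perm_inv (ρ : Perm (Fin n)) : perm ρ * perm ρ⁻¹ = 1 := by
  rw [← map_mul, mul_inv_cancel, map_one]

theorem perm_inv_mul_perm (ρ : Perm (Fin n)) : perm ρ⁻¹ * perm ρ = 1 := by
  rw [← map_mul, inv_mul_cancel, map_one]

/-- A permutation that fixes the points of the first arc commutes with `E_1`. -/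
theorem perm_comm_pE_zero (i₀ : Fin (n - 1)) (h₀ : (i₀ : ℕ) = 0) (ρ : Perm (Fin n))
    (h : ρ (lo i₀) = lo i₀) (h' : ρ (hi i₀) = hi i₀) : perm ρ * pE i₀ = pE i₀ * perm ρ := by
  revert h h'
  refine descent_induction (p := fun ρ => ρ (lo i₀) = lo i₀ → ρ (hi i₀) = hi i₀ →
    perm ρ * pE i₀ = pE i₀ * perm ρ) (by simp) (fun ρ i hd ih h h' => ?_) ρ
  -- A permutation fixing the first two points has no descent at index 0 or 1: at index 1 the next
  -- value would have to be the first point, which is already taken. So only generators far from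
  -- `E_1` are stripped, and the hypotheses survive the induction.
  have hne0 : (i : ℕ) ≠ 0 := fun hi0 => by
    have : i = i₀ := Fin.ext (by omega)
    rw [this, h, h'] at hd
    exact (lo_lt_hi i₀).not_gt hd
  have hne1 : (i : ℕ) ≠ 1 := fun hi1 => by
    have h4 : lo i = hi i₀ := hi_eq_lo (by omega)
    rw [h4, h'] at hd
    have h5 : ρ (hi i) = lo i₀ := Fin.ext (by
      have := Fin.lt_def.1 hd
      simp only [hi, lo, h₀] at this ⊢
      omega)
    have h6 : hi i = lo i₀ := ρ.injective (h5.trans h.symm)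
    simp [hi, lo, h₀] at h6
  have hfar : 2 ≤ |((i : ℕ) : ℤ) - ((i₀ : ℕ) : ℤ)| := by
    rw [h₀, abs_of_nonneg (by simp)]; push_cast; omega
  have hfar' := hfar
  rw [abs_sub_comm] at hfar'
  have hf := adj_far hfar'
  have e := ih (by rw [Perm.mul_apply, hf.1, h]) (by rw [Perm.mul_apply, hf.2, h'])
  have hρ : perm ρ = perm (ρ * adj i) * pv i := by
    rw [← perm_adj, ← map_mul, mul_assoc, adj_mul_adj, mul_one]
  rw [hρ, mul_assoc, pv_mul_pE_far hfar, ← mul_assoc, e, mul_assoc]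

theorem exists_perm_pair {a b c d : Fin n} (h : a ≠ b) (h' : c ≠ d) :
    ∃ ρ : Perm (Fin n), ρ a = c ∧ ρ b = d := by
  obtain ⟨ρ, hρ⟩ := Perm.exists_extending_pair ![a, b] ![c, d]
    (by intro i j; fin_cases i <;> fin_cases j <;> simp [h, h.symm])
    (by intro i j; fin_cases i <;> fin_cases j <;> simp [h', h'.symm])
  exact ⟨ρ, hρ 0, hρ 1⟩

open Classical in
/-- The element of the presented algebra with arcs joining the points `a` and `b` in both rows. -/
def arc (a b : Fin n) : Presented n :=
  if h : ∃ (i₀ : Fin (n - 1)) (ρ : Perm (Fin n)), (i₀ : ℕ) = 0 ∧ ρ (lo i₀) = a ∧ ρ (hi i₀) = b then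
    perm h.choose_spec.choose * pE h.choose * perm h.choose_spec.choose⁻¹
  -- This branch occurs only for `a = b`, by `exists_arc_eq`.
  else 0

/-- Two permutations with the same values at the first pair differ by one that fixes this pair, and
that one commutes with `E_1`. -/
theorem arc_eq {i₀ : Fin (n - 1)} (h₀ : (i₀ : ℕ) = 0) (ρ : Perm (Fin n)) :
    arc (ρ (lo i₀)) (ρ (hi i₀)) = perm ρ * pE i₀ * perm ρ⁻¹ := by
  have h : ∃ (j : Fin (n - 1)) (τ : Perm (Fin n)), (j : ℕ) = 0 ∧ τ (lo j) = ρ (lo i₀) ∧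
    τ (hi j) = ρ (hi i₀) := ⟨i₀, ρ, h₀, rfl, rfl⟩
  rw [arc, dif_pos h]
  obtain ⟨h1, h2, h3⟩ := h.choose_spec.choose_spec
  set τ := h.choose_spec.choose
  have hi0 : h.choose = i₀ := Fin.ext (h1.trans h₀.symm)
  rw [hi0] at h2 h3 ⊢
  have := perm_comm_pE_zero i₀ h₀ (ρ⁻¹ * τ) (by rw [Perm.mul_apply, h2]; exact ρ.symm_apply_apply _)
    (by rw [Perm.mul_apply, h3]; exact ρ.symm_apply_apply _)
  obtain ⟨κ, hκ⟩ : ∃ κ, τ = ρ * κ := ⟨ρ⁻¹ * τ, by group⟩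
  rw [hκ, inv_mul_cancel_left] at this
  rw [hκ, map_mul, mul_assoc (perm ρ), this, mul_inv_rev, map_mul]
  simp only [mul_assoc]
  rw [← mul_assoc (perm κ), perm_mul_perm_inv, one_mul]

theorem exists_first {a b : Fin n} (h : a ≠ b) : ∃ i₀ : Fin (n - 1), (i₀ : ℕ) = 0 := by
  have : 1 < n := by
    have := Fintype.one_lt_card_iff.2 ⟨a, b, h⟩
    simpa using this
  exact ⟨⟨0, by omega⟩, rfl⟩

theorem exists_arc_eq {a b : Fin n} (h : a ≠ b) : ∃ (i₀ : Fin (n - 1)) (ρ : Perm (Fin n)),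
    (i₀ : ℕ) = 0 ∧ ρ (lo i₀) = a ∧ ρ (hi i₀) = b := by
  obtain ⟨i₀, h₀⟩ := exists_first h
  obtain ⟨ρ, h1, h2⟩ := exists_perm_pair (lo_ne_hi i₀) h
  exact ⟨i₀, ρ, h₀, h1, h2⟩

theorem perm_mul_arc (τ : Perm (Fin n)) {a b : Fin n} (h : a ≠ b) :
    perm τ * arc a b = arc (τ a) (τ b) * perm τ := by
  obtain ⟨i₀, ρ, h₀, rfl, rfl⟩ := exists_arc_eq h
  rw [← Perm.mul_apply, ← Perm.mul_apply, arc_eq h₀, arc_eq h₀, mul_inv_rev, map_mul, map_mul]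
  simp only [mul_assoc]
  rw [perm_inv_mul_perm, mul_one]

/-- Reduces identities between arcs to one standard position, since permutations carry any tuple of
distinct points to any other. -/
theorem arc_apply_apply (τ : Perm (Fin n)) {a b : Fin n} (h : a ≠ b) :
    arc (τ a) (τ b) = perm τ * arc a b * perm τ⁻¹ := by
  rw [perm_mul_arc τ h, mul_assoc, perm_mul_perm_inv, mul_one]

theorem pv_mul_pv (i : Fin (n - 1)) : pv i * pv i = (1 : Presented n) := coxeterRel_pv.sq i

/-- By induction on the index: `v_i v_j E_i = E_j v_i v_j` for `j = i + 1` says that `E_j` is the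
conjugate of `E_i` by a permutation that moves pair `i` to pair `j`. -/
theorem arc_lo_hi (i : Fin (n - 1)) : arc (lo i) (hi i) = pE i := by
  obtain ⟨i, hi'⟩ := i
  induction i with
  | zero => simpa using arc_eq (i₀ := ⟨0, hi'⟩) rfl 1
  | succ k ih =>
    set i : Fin (n - 1) := ⟨k, by omega⟩ with hi
    set j : Fin (n - 1) := ⟨k + 1, hi'⟩ with hj
    have hij : |((i : ℕ) : ℤ) - ((j : ℕ) : ℤ)| = 1 := abs_sub_eq_one_iff.2 (Or.inl rfl)
    have e := ih (by omega)
    have h4 : lo j = VirtualTL.hi i := hi_eq_lo rfl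
    have e2 : adj j (lo i) = lo i := adj_of_ne (by simp [lo, hi, hj])
      (by simp [lo, VirtualTL.hi, hi, hj]; omega)
    have e3 : adj i (VirtualTL.hi j) = VirtualTL.hi j := adj_of_ne
      (by simp [lo, VirtualTL.hi, hi, hj]; omega) (by simp [VirtualTL.hi, hi, hj])
    have h1 : (adj i * adj j) (lo i) = lo j := by rw [Perm.mul_apply, e2, adj_lo, h4]
    have h2 : (adj i * adj j) (VirtualTL.hi i) = VirtualTL.hi j := by
      rw [Perm.mul_apply, ← h4, adj_lo, e3]
    have := arc_apply_apply (adj i * adj j) (lo_ne_hi i)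
    rw [h1, h2, e, map_mul, perm_adj, perm_adj, pv_mul_pv_mul_pE hij, mul_inv_rev, map_mul, adj_inv,
      adj_inv, perm_adj, perm_adj] at this
    rw [this]
    simp only [mul_assoc]
    rw [← mul_assoc (pv j), pv_mul_pv, one_mul, pv_mul_pv, mul_one]

theorem conj_mul_conj (ρ : Perm (Fin n)) (x y : Presented n) :
    perm ρ * x * perm ρ⁻¹ * (perm ρ * y * perm ρ⁻¹) = perm ρ * (x * y) * perm ρ⁻¹ := by
  calc _ = perm ρ * x * (perm ρ⁻¹ * perm ρ) * y * perm ρ⁻¹ := by simp only [mul_assoc]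
    _ = _ := by rw [perm_inv_mul_perm, mul_one, mul_assoc (perm ρ)]

theorem arc_mul_self {a b : Fin n} (h : a ≠ b) : arc a b * arc a b = (X : ℤ[X]) • arc a b := by
  obtain ⟨i, ρ, h₀, rfl, rfl⟩ := exists_arc_eq h
  rw [arc_apply_apply ρ (lo_ne_hi i), arc_lo_hi, conj_mul_conj, pE_mul_pE, mul_smul_comm,
    smul_mul_assoc]

theorem swap_conj (ρ : Perm (Fin n)) (a b : Fin n) :
    swap (ρ a) (ρ b) = ρ * swap a b * ρ⁻¹ := swap_apply_apply ρ a b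

theorem arc_mul_swap {a b : Fin n} (h : a ≠ b) : arc a b * perm (swap a b) = arc a b := by
  obtain ⟨i, ρ, h₀, rfl, rfl⟩ := exists_arc_eq h
  rw [arc_apply_apply ρ (lo_ne_hi i), arc_lo_hi, swap_conj, ← adj, map_mul, map_mul, perm_adj,
    conj_mul_conj, pE_mul_pv]

theorem arc_symm {a b : Fin n} (h : a ≠ b) : arc b a = arc a b := by
  obtain ⟨i, ρ, h₀, rfl, rfl⟩ := exists_arc_eq h
  have hs : arc (hi i) (lo i) = arc (lo i) (hi i) := by
    have := arc_apply_apply (adj i) (lo_ne_hi i)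
    rwa [adj_lo, adj_hi, adj_inv, arc_lo_hi, perm_adj, pv_mul_pE, pE_mul_pv, ← arc_lo_hi] at this
  rw [arc_apply_apply ρ (lo_ne_hi i), arc_apply_apply ρ (lo_ne_hi i).symm, hs]

/-- Write `E_j` as `v_i v_j E_i v_j v_i`; then `E_i` absorbs `v_i`, and `E_i v_j E_i` collapses to
`E_i`. -/
theorem pE_mul_pE_near {i j : Fin (n - 1)} (h : |((i : ℕ) : ℤ) - ((j : ℕ) : ℤ)| = 1) :
    pE i * pE j = pE i * pv j * pv i := by
  have h1 : pE j = pv i * pv j * pE i * (pv j * pv i) := by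
    rw [pv_mul_pv_mul_pE h]
    simp only [mul_assoc]
    rw [← mul_assoc (pv j), pv_mul_pv, one_mul, pv_mul_pv, mul_one]
  rw [h1]
  simp only [← mul_assoc]
  rw [pE_mul_pv, pE_mul_pv_mul_pE h]

theorem arc_mul_arc_near {a b c : Fin n} (hab : a ≠ b) (hbc : b ≠ c) (hac : a ≠ c) :
    arc a b * arc b c = arc a b * perm (swap a c) := by
  have hn : 2 < n := by
    have := Fintype.two_lt_card_iff.2 ⟨a, b, c, hab, hac, hbc⟩
    simpa using this
  set i : Fin (n - 1) := ⟨0, by omega⟩ with hi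
  set j : Fin (n - 1) := ⟨1, by omega⟩ with hj
  have hij : |((i : ℕ) : ℤ) - ((j : ℕ) : ℤ)| = 1 := by simp [hi, hj]
  have h4 : lo j = VirtualTL.hi i := hi_eq_lo rfl
  have h5 : lo i ≠ VirtualTL.hi j := by simp [lo, VirtualTL.hi, hi, hj]
  have hl := lo_ne_hi i
  have hl' := lo_ne_hi j
  rw [h4] at hl'
  obtain ⟨ρ, hρ⟩ := Perm.exists_extending_pair ![lo i, VirtualTL.hi i, VirtualTL.hi j] ![a, b, c]
    (by intro i j; fin_cases i <;> fin_cases j <;> simp [hl, hl', h5, hl.symm, hl'.symm, h5.symm])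
    (by intro i j; fin_cases i <;> fin_cases j <;>
      simp [hab, hbc, hac, hab.symm, hbc.symm, hac.symm])
  have r1 : ρ (lo i) = a := hρ 0
  have r2 : ρ (VirtualTL.hi i) = b := hρ 1
  have r3 : ρ (VirtualTL.hi j) = c := hρ 2
  have hbase : arc (lo i) (VirtualTL.hi i) * arc (VirtualTL.hi i) (VirtualTL.hi j) =
      arc (lo i) (VirtualTL.hi i) * perm (swap (lo i) (VirtualTL.hi j)) := by
    -- The transposition is `adj i * adj j * adj i`, and `E_i` absorbs its first letter.
    have hsw : swap (lo i) (VirtualTL.hi j) = adj i * adj j * adj i := by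
      have := swap_mul_swap_mul_swap (x := VirtualTL.hi j) (y := VirtualTL.hi i) (z := lo i)
        hl'.symm h5.symm
      rw [adj, adj, h4, ← this, swap_comm (VirtualTL.hi i) (lo i), swap_comm (VirtualTL.hi j)]
    rw [hsw, map_mul, map_mul, perm_adj, perm_adj, ← h4, arc_lo_hi, h4, arc_lo_hi,
      pE_mul_pE_near hij, ← mul_assoc, ← mul_assoc, pE_mul_pv]
  subst r1 r2 r3
  rw [arc_apply_apply ρ hl, arc_apply_apply ρ hl', swap_conj, map_mul, map_mul]
  rw [conj_mul_conj, conj_mul_conj, hbase]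

theorem arc_comm {a b c d : Fin n} (hab : a ≠ b) (hac : a ≠ c) (had : a ≠ d) (hbc : b ≠ c)
    (hbd : b ≠ d) (hcd : c ≠ d) : arc a b * arc c d = arc c d * arc a b := by
  have hinj : Function.Injective ![a, b, c, d] := by
    intro i j
    fin_cases i <;> fin_cases j <;> simp [hab, hac, had, hbc, hbd, hcd, hab.symm, hac.symm,
      had.symm, hbc.symm, hbd.symm, hcd.symm]
  have hn : 4 ≤ n := by simpa using Fintype.card_le_of_injective _ hinj
  set i : Fin (n - 1) := ⟨0, by omega⟩ with hi
  set j : Fin (n - 1) := ⟨2, by omega⟩ with hj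
  have hij : 2 ≤ |((i : ℕ) : ℤ) - ((j : ℕ) : ℤ)| := by simp [hi, hj]
  obtain ⟨ρ, hρ⟩ := Perm.exists_extending_pair
    ![lo i, VirtualTL.hi i, lo j, VirtualTL.hi j] ![a, b, c, d]
    (by intro k l; fin_cases k <;> fin_cases l <;> simp [lo, VirtualTL.hi, hi, hj]) hinj
  have r1 : ρ (lo i) = a := hρ 0
  have r2 : ρ (VirtualTL.hi i) = b := hρ 1
  have r3 : ρ (lo j) = c := hρ 2
  have r4 : ρ (VirtualTL.hi j) = d := hρ 3
  subst r1 r2 r3 r4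
  rw [arc_apply_apply ρ (lo_ne_hi i), arc_apply_apply ρ (lo_ne_hi j), conj_mul_conj, conj_mul_conj,
    arc_lo_hi, arc_lo_hi, pE_mul_pE_far hij]

/-- Multiply the two arcs by `arc b c`. Combining it with `arc a b` gives `swap a c`, combining it
with `arc c d` gives `swap b d`; so both transpositions act alike on the product, and together they
act trivially. -/
theorem arc_mul_arc_mul_swap_mul_swap {a b c d : Fin n} (hab : a ≠ b) (hac : a ≠ c) (had : a ≠ d)
    (hbc : b ≠ c) (hbd : b ≠ d) (hcd : c ≠ d) :
    arc a b * arc c d * perm (swap a c * swap b d) = arc a b * arc c d := by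
  have hcomm := arc_comm hab hac had hbc hbd hcd
  have h : arc a b * arc c d * perm (swap a c) = arc a b * arc c d * perm (swap b d) := by
    calc arc a b * arc c d * perm (swap a c)
        = arc c d * (arc a b * perm (swap a c)) := by rw [hcomm, mul_assoc]
      _ = arc c d * arc a b * arc b c := by rw [← arc_mul_arc_near hab hbc hac, mul_assoc]
      _ = arc a b * (arc d c * arc c b) := by
          rw [← hcomm, mul_assoc, arc_symm hcd, arc_symm hbc]
      _ = arc a b * arc c d * perm (swap b d) := by
          rw [arc_mul_arc_near hcd.symm hbc.symm hbd.symm, arc_symm hcd, swap_comm d b, mul_assoc]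
  rw [map_mul, ← mul_assoc, h, mul_assoc _ (perm (swap b d)), ← map_mul, swap_mul_self, map_one,
    mul_one]

end Presented

open Presented

/-! ### Products of disjoint arcs -/

/-- `x` is a product of the arcs joining the points exchanged by the involution `μ`. -/
inductive ArcProd {n : ℕ} : Perm (Fin n) → Presented n → Prop
  | one : ArcProd 1 1
  | cons {μ x} (a b : Fin n) (hab : a ≠ b) (ha : μ a = a) (hb : μ b = b) (h : ArcProd μ x) :
      ArcProd (swap a b * μ) (arc a b * x)

namespace ArcProd

variable {n : ℕ} {μ : Perm (Fin n)} {x y : Presented n}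

theorem conj (h : ArcProd μ x) (τ : Perm (Fin n)) :
    ArcProd (τ * μ * τ⁻¹) (perm τ * x * perm τ⁻¹) := by
  induction h with
  | one => simpa [perm_mul_perm_inv] using one
  | @cons μ x a b hab ha hb h ih =>
    have := ih.cons (τ a) (τ b) (τ.injective.ne hab) (by simp [ha]) (by simp [hb])
    rw [swap_conj, arc_apply_apply τ hab, conj_mul_conj] at this
    convert this using 1
    group

/-- Any arc of the product can be moved to the front. -/
theorem exists_front (h : ArcProd μ x) {a : Fin n} (ha : μ a ≠ a) :
    ∃ y, ArcProd (swap a (μ a) * μ) y ∧ x = arc a (μ a) * y := by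
  induction h with
  | one => simp at ha
  | @cons μ x c d hcd hc hd h ih =>
    have hcancel : swap c d * (swap c d * μ) = μ := by
      rw [← mul_assoc, swap_mul_self, one_mul]
    by_cases hac : a = c
    · subst hac
      have e : (swap a d * μ) a = d := by simp [hc]
      rw [e, hcancel]
      exact ⟨x, h, rfl⟩
    by_cases had : a = d
    · subst had
      have e : (swap c a * μ) a = c := by simp [hd]
      rw [e, swap_comm a c, hcancel, arc_symm hcd]
      exact ⟨x, h, rfl⟩
    have h1 : μ a ≠ c := fun h => hac (μ.injective (h.trans hc.symm))
    have h2 : μ a ≠ d := fun h => had (μ.injective (h.trans hd.symm))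
    have e : (swap c d * μ) a = μ a := by
      rw [Perm.mul_apply, swap_apply_of_ne_of_ne h1 h2]
    rw [e] at ha ⊢
    obtain ⟨y, hy, rfl⟩ := ih ha
    refine ⟨arc c d * y, ?_, ?_⟩
    · have := hy.cons c d hcd
        (by rw [Perm.mul_apply, hc, swap_apply_of_ne_of_ne (Ne.symm hac) h1.symm])
        (by rw [Perm.mul_apply, hd, swap_apply_of_ne_of_ne (Ne.symm had) h2.symm])
      convert this using 1
      rw [← mul_assoc, ← mul_assoc]
      congr 1
      refine (Perm.disjoint_iff_disjoint_support.2 ?_).commute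
      rw [Perm.support_swap hcd, Perm.support_swap (Ne.symm ha)]
      simp only [Finset.disjoint_left, Finset.mem_insert, Finset.mem_singleton]
      grind
    · rw [← mul_assoc, ← mul_assoc,
        arc_comm hcd (Ne.symm hac) h1.symm (Ne.symm had) h2.symm (Ne.symm ha)]

/-- The first arc of one product can be moved to the front of the other and cancelled; an empty
product cannot have the involution of a nonempty one. -/
theorem unique (h : ArcProd μ x) (h' : ArcProd μ y) : x = y := by
  induction h generalizing y with
  | one =>
    generalize hν : (1 : Perm (Fin n)) = ν at h'
    cases h' with
    | one => rfl
    | @cons μ x a b hab ha hb h =>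
      have := congrArg (fun f : Perm (Fin n) => f a) hν
      simp [ha] at this
      exact absurd this hab
  | @cons μ x a b hab ha hb h ih =>
    have e : (swap a b * μ) a = b := by simp [ha]
    obtain ⟨z, hz, rfl⟩ := h'.exists_front (a := a) (by rw [e]; exact hab.symm)
    rw [e, ← mul_assoc, swap_mul_self, one_mul] at hz
    rw [e, ih hz]

/-- Splitting off the arc at a moved point shrinks the support. -/
theorem _root_.VirtualTL.exists_arcProd (μ : Perm (Fin n)) (hμ : ∀ a, μ (μ a) = a) :
    ∃ x, ArcProd μ x := by
  generalize hk : μ.support.card = k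
  induction k using Nat.strong_induction_on generalizing μ with
  | _ k ih =>
    by_cases h1 : μ = 1
    · exact ⟨1, h1 ▸ one⟩
    obtain ⟨a, ha⟩ : ∃ a, μ a ≠ a := by
      by_contra hc
      push Not at hc
      exact h1 (Equiv.ext hc)
    have hea : (swap a (μ a) * μ) a = a := by simp
    have heb : (swap a (μ a) * μ) (μ a) = μ a := by simp [hμ]
    have hec : ∀ c, c ≠ a → c ≠ μ a → (swap a (μ a) * μ) c = μ c := fun c h h' => by
      rw [Perm.mul_apply, swap_apply_of_ne_of_ne]
      · intro hc; exact h' (by rw [← hc, hμ])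
      · intro hc; exact h (μ.injective hc)
    have hlt : (swap a (μ a) * μ).support.card < k := by
      rw [← hk]
      refine Finset.card_lt_card (Finset.ssubset_iff_subset_ne.2 ⟨fun c hc => ?_, fun hc => ?_⟩)
      · rw [Perm.mem_support] at hc ⊢
        by_cases h : c = a
        · rwa [h]
        by_cases h' : c = μ a
        · exact absurd (h' ▸ heb) hc
        · rwa [hec c h h'] at hc
      · have : a ∈ (swap a (μ a) * μ).support := by rw [hc, Perm.mem_support]; exact ha
        rw [Perm.mem_support] at this
        exact this hea
    obtain ⟨x, hx⟩ := ih _ hlt (swap a (μ a) * μ) (fun c => by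
      by_cases h : c = a
      · rw [h, hea, hea]
      by_cases h' : c = μ a
      · rw [h', heb, heb]
      · rw [hec c h h', hec _ (fun hc => h' (by rw [← hc, hμ])) (fun hc => h (μ.injective hc)), hμ])
      rfl
    have := hx.cons a (μ a) (Ne.symm ha) hea heb
    rw [← mul_assoc, swap_mul_self, one_mul] at this
    exact ⟨_, this⟩

/-- Conjugation by `τ` yields an arc product for the same involution, hence the same element. -/
theorem perm_comm (h : ArcProd μ x) {τ : Perm (Fin n)} (hτ : τ * μ * τ⁻¹ = μ) :
    perm τ * x = x * perm τ := by
  have h1 := h.conj τ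
  rw [hτ] at h1
  have h2 := h1.unique h
  calc perm τ * x = perm τ * x * perm τ⁻¹ * perm τ := by rw [mul_assoc, perm_inv_mul_perm, mul_one]
    _ = x * perm τ := by rw [h2]

theorem perm_swap_comm (h : ArcProd μ x) {a b : Fin n} (ha : μ a = a) (hb : μ b = b) :
    perm (swap a b) * x = x * perm (swap a b) := by
  refine h.perm_comm ?_
  rw [swap_inv, mul_assoc, mul_swap_eq_swap_mul, ha, hb, ← mul_assoc, swap_mul_self, one_mul]

theorem invol (h : ArcProd μ x) (a : Fin n) : μ (μ a) = a := by
  have : μ * μ = 1 := by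
    induction h with
    | one => rfl
    | @cons μ x a b hab ha hb h ih =>
      rw [mul_assoc, ← mul_assoc μ, mul_swap_eq_swap_mul, ha, hb, mul_assoc, ih, mul_one,
        swap_mul_self]
  exact congrArg (fun f : Perm (Fin n) => f a) this

/-- Two arcs of the product can be moved to the front. -/
theorem exists_front_two (h : ArcProd μ x) {a b c d : Fin n} (ha : μ a = b) (hc : μ c = d)
    (hab : a ≠ b) (hcd : c ≠ d) (hca : c ≠ a) (hcb : c ≠ b) :
    ∃ z, ArcProd (swap c d * (swap a b * μ)) z ∧ x = arc a b * (arc c d * z) := by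
  have hi := h.invol
  have hda : d ≠ a := fun e => hcb (by rw [← ha, ← e, ← hc, hi])
  have hdb : d ≠ b := fun e => hca (μ.injective (by rw [hc, ha, e]))
  obtain ⟨y, hy, rfl⟩ := h.exists_front (a := a) (by rw [ha]; exact hab.symm)
  rw [ha] at hy ⊢
  have e : (swap a b * μ) c = d := by
    rw [Perm.mul_apply, hc, swap_apply_of_ne_of_ne hda hdb]
  obtain ⟨z, hz, rfl⟩ := hy.exists_front (a := c) (by rw [e]; exact hcd.symm)
  rw [e] at hz ⊢
  exact ⟨z, hz, rfl⟩

theorem mul_perm_swap (h : ArcProd μ x) {a : Fin n} (ha : μ a ≠ a) :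
    x * perm (swap a (μ a)) = x := by
  have hi := h.invol
  obtain ⟨y, hy, rfl⟩ := h.exists_front ha
  rw [mul_assoc, ← hy.perm_swap_comm (by simp) (by simp [hi]), ← mul_assoc,
    arc_mul_swap (Ne.symm ha)]

theorem mul_perm_swap_mul_swap (h : ArcProd μ x) {a b c d : Fin n} (ha : μ a = b) (hc : μ c = d)
    (hab : a ≠ b) (hcd : c ≠ d) (hca : c ≠ a) (hcb : c ≠ b) :
    x * perm (swap a c * swap b d) = x := by
  have hi := h.invol
  have hda : d ≠ a := fun e => hcb (by rw [← ha, ← e, ← hc, hi])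
  have hdb : d ≠ b := fun e => hca (μ.injective (by rw [hc, ha, e]))
  have hb : μ b = a := by rw [← ha, hi]
  have hd : μ d = c := by rw [← hc, hi]
  obtain ⟨z, hz, rfl⟩ := h.exists_front_two ha hc hab hcd hca hcb
  have hfix : ∀ k, k = a ∨ k = b ∨ k = c ∨ k = d → (swap c d * (swap a b * μ)) k = k := by
    simp only [Perm.mul_apply, swap_apply_def]
    grind
  have hz1 : z * perm (swap a c * swap b d) = perm (swap a c * swap b d) * z := by
    rw [map_mul, ← mul_assoc, ← hz.perm_swap_comm (hfix a (by simp)) (hfix c (by simp)), mul_assoc,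
      mul_assoc, ← hz.perm_swap_comm (hfix b (by simp)) (hfix d (by simp))]
  rw [mul_assoc, mul_assoc, hz1, ← mul_assoc, ← mul_assoc, ← mul_assoc,
    arc_mul_arc_mul_swap_mul_swap hab hca.symm hda.symm hcb.symm hdb.symm hcd, mul_assoc]

/-- Strong induction on the support of `g`: a flip of an arc or an exchange of two arcs, both
absorbed by `x`, brings `g a` back to `a`. -/
theorem mul_perm (h : ArcProd μ x) (g : Perm (Fin n)) (hg : ∀ a, g (μ a) = μ (g a))
    (hfix : ∀ a, μ a = a → g a = a) : x * perm g = x := by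
  have hi := h.invol
  generalize hk : g.support.card = k
  induction k using Nat.strong_induction_on generalizing g with
  | _ k ih =>
    by_cases h1 : g = 1
    · rw [h1, map_one, mul_one]
    obtain ⟨a, ha⟩ : ∃ a, g a ≠ a := by
      by_contra hc
      push Not at hc
      exact h1 (Equiv.ext hc)
    have hab : μ a ≠ a := fun h => ha (hfix a h)
    -- With `f` an involution absorbed by `x`, the product `f * g` fixes `a` in addition to all
    -- fixed points of `g`, so induction applies to it, and `g = f * (f * g)`.
    have step : ∀ f : Perm (Fin n), x * perm f = x → f * f = 1 → (∀ a, f (μ a) = μ (f a)) →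
        (∀ a, μ a = a → f a = a) → f (g a) = a → (∀ c, g c = c → f c = c) → x * perm g = x := by
      intro f hf hff hfμ hffix hfa hfg
      have hlt : (f * g).support.card < k := by
        rw [← hk]
        refine Finset.card_lt_card (Finset.ssubset_iff_subset_ne.2 ⟨fun c hc => ?_, fun hc => ?_⟩)
        · rw [Perm.mem_support] at hc ⊢
          intro hgc
          exact hc (by rw [Perm.mul_apply, hgc, hfg c hgc])
        · have : a ∈ (f * g).support := by rw [hc, Perm.mem_support]; exact ha
          rw [Perm.mem_support] at this
          exact this hfa
      have := ih _ hlt (f * g) (fun c => by rw [Perm.mul_apply, hg, hfμ]; rfl)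
        (fun c hc => by rw [Perm.mul_apply, hfix c hc, hffix c hc]) rfl
      calc x * perm g = x * perm (f * (f * g)) := by rw [← mul_assoc, hff, one_mul]
        _ = x * perm f * perm (f * g) := by rw [map_mul perm f, mul_assoc]
        _ = x := by rw [hf, this]
    by_cases hc : g a = μ a
    · refine step (swap a (μ a)) (h.mul_perm_swap hab) (swap_mul_self _ _) ?_ ?_ ?_ ?_
      all_goals simp only [swap_apply_def]; grind
    · have hgg : μ (g a) ≠ g a := fun h => hab (g.injective (by rw [hg, h]))
      have hne : g a ≠ a := ha
      have hd : μ (g a) ≠ a := fun e => hc (by rw [← hi (g a), e])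
      have hd' : μ (g a) ≠ μ a := fun e => ha (μ.injective e)
      refine step (swap a (g a) * swap (μ a) (μ (g a)))
        (h.mul_perm_swap_mul_swap rfl rfl hab.symm hgg.symm ha hc) ?_ ?_ ?_ ?_ ?_
      · ext k
        simp only [Perm.mul_apply, swap_apply_def, Perm.one_apply]
        grind
      · simp only [Perm.mul_apply, swap_apply_def]; grind
      · simp only [Perm.mul_apply, swap_apply_def]; grind
      · simp only [Perm.mul_apply, swap_apply_def]; grind
      · intro k hk
        have n1 : k ≠ a := fun e => ha (e ▸ hk)
        have n2 : k ≠ g a := fun e => ha (g.injective (e ▸ hk))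
        have n3 : k ≠ μ a := fun e => ha (μ.injective (by rw [← hg, ← e, hk]))
        have n4 : k ≠ μ (g a) := fun e =>
          ha (g.injective (μ.injective (by rw [← hg (g a), ← e, hk])))
        rw [Perm.mul_apply, swap_apply_of_ne_of_ne n3 n4, swap_apply_of_ne_of_ne n1 n2]

/-! ### Multiplication by an arc -/

theorem arc_mul_of_arc (h : ArcProd μ x) {a b : Fin n} (hab : a ≠ b) (ha : μ a = b) :
    arc a b * x = (X : ℤ[X]) • x := by
  obtain ⟨y, hy, rfl⟩ := h.exists_front (a := a) (by rw [ha]; exact hab.symm)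
  rw [ha, ← mul_assoc, arc_mul_self hab, smul_mul_assoc]

/-- With `arc b c` in front, `arc a b * arc b c` becomes `arc a b * perm (swap a c)`, and the
transposition passes the other arcs because they avoid `a` and `c`. The result matches
`Shape.cap_comp_mixed`. -/
theorem arc_mul_of_mixed (h : ArcProd μ x) {a b c : Fin n} (hab : a ≠ b) (ha : μ a = a)
    (hb : μ b = c) (hbc : b ≠ c) :
    ∃ y, ArcProd (swap a b * (swap b c * μ)) y ∧ arc a b * x = y * perm (swap a c) := by
  have hi := h.invol
  have hc : μ c = b := by rw [← hb, hi]
  have hac : a ≠ c := fun e => hab (by rw [← ha, e, hc])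
  obtain ⟨y, hy, rfl⟩ := h.exists_front (a := b) (by rw [hb]; exact hbc.symm)
  rw [hb] at hy ⊢
  have ha' : (swap b c * μ) a = a := by
    rw [Perm.mul_apply, ha, swap_apply_of_ne_of_ne hab hac]
  refine ⟨_, hy.cons a b hab ha' (by simp [hb]), ?_⟩
  rw [← mul_assoc, arc_mul_arc_near hab hbc hac, mul_assoc, mul_assoc,
    hy.perm_swap_comm ha' (by simp [hc])]

/-- `arc b a * arc a c` produces `swap b c`, which turns `arc b d` into `arc c d` and passes the
remaining arcs. The result matches `Shape.cap_comp_two_arcs`. -/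
theorem arc_mul_of_two_arcs (h : ArcProd μ x) {a b c d : Fin n} (hab : a ≠ b) (ha : μ a = c)
    (hb : μ b = d) (hac : a ≠ c) (hbd : b ≠ d) (had : a ≠ d) :
    ∃ y, ArcProd (swap a b * (swap c d * (swap b d * (swap a c * μ)))) y ∧
      arc a b * x = y * perm (swap b c) := by
  have hi := h.invol
  have hc : μ c = a := by rw [← ha, hi]
  have hd : μ d = b := by rw [← hb, hi]
  have hbc : b ≠ c := fun e => had (by rw [← hb, e, hc])
  have hcd : c ≠ d := fun e => hab (by rw [← hc, e, hd])
  obtain ⟨z, hz, rfl⟩ := h.exists_front_two ha hb hac hbd hab.symm hbc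
  have hfix : ∀ k, k = a ∨ k = b ∨ k = c ∨ k = d → (swap b d * (swap a c * μ)) k = k := by
    simp only [Perm.mul_apply, swap_apply_def]
    grind
  have hfix' : ∀ k, k = a ∨ k = b →
      (swap c d * (swap b d * (swap a c * μ))) k = k := by
    intro k hk
    rw [Perm.mul_apply, hfix k (by tauto)]
    simp only [swap_apply_def]
    grind
  refine ⟨_, (hz.cons c d hcd (hfix c (by simp)) (hfix d (by simp))).cons a b hab
    (hfix' a (by simp)) (hfix' b (by simp)), ?_⟩
  calc arc a b * (arc a c * (arc b d * z))
      = arc b a * arc a c * (arc b d * z) := by rw [arc_symm hab, mul_assoc]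
    _ = arc a b * (perm (swap b c) * arc b d * z) := by
        rw [arc_mul_arc_near hab.symm hac hbc, arc_symm hab]; simp only [mul_assoc]
    _ = arc a b * (arc c d * (perm (swap b c) * z)) := by
        rw [perm_mul_arc _ hbd, swap_apply_left, swap_apply_of_ne_of_ne hbd.symm hcd.symm,
          mul_assoc]
    _ = _ := by
        rw [hz.perm_swap_comm (hfix b (by simp)) (hfix c (by simp))]; simp only [mul_assoc]

end ArcProd

/-! ### The inverse of the comparison map -/

/-- `x` is a product of arcs and a permutation that represents the tangle `T`. -/
def Represents {n : ℕ} (T : FlatTangle n) (x : Presented n) : Prop :=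
  ∃ μ σ y, Shape T μ σ ∧ ArcProd μ y ∧ x = y * perm σ

section Represents

variable {n : ℕ} {T : FlatTangle n} {x y : Presented n}

theorem exists_represents (T : FlatTangle n) : ∃ x, Represents T x := by
  obtain ⟨μ, σ, h⟩ := T.exists_shape
  obtain ⟨y, hy⟩ := exists_arcProd μ h.invol
  exact ⟨_, μ, σ, y, h, hy, rfl⟩

/-- The tangle determines `μ`, hence the arc product, and two choices of `σ` differ by a permutation
that the arc product absorbs. -/
theorem Represents.unique (hx : Represents T x) (hy : Represents T y) : x = y := by
  obtain ⟨μ, σ, x, h, hx, rfl⟩ := hx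
  obtain ⟨μ', σ', y, h', hy, rfl⟩ := hy
  obtain rfl := h.involution_unique h'
  obtain rfl := hx.unique hy
  have hg := hx.mul_perm (σ' * σ⁻¹) (h.comm_of_shape h') fun a => h.eq_of_fixed h'
  conv_lhs => rw [← hg]
  rw [mul_assoc, ← map_mul, inv_mul_cancel_right]

theorem represents_id : Represents (.id n) 1 :=
  ⟨1, 1, 1, shape_id n, .one, by rw [map_one, mul_one]⟩

theorem Represents.v_comp (h : Represents T x) (i : Fin (n - 1)) :
    Represents ((FlatTangle.v i).comp T) (pv i * x) := by
  obtain ⟨μ, σ, y, h, hy, rfl⟩ := h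
  refine ⟨_, _, _, h.v_comp i, hy.conj (adj i), ?_⟩
  rw [map_mul, adj_inv, perm_adj]
  simp only [mul_assoc]
  rw [← mul_assoc (pv i) (pv i), pv_mul_pv, one_mul]

theorem Represents.e_comp (h : Represents T x) (i : Fin (n - 1)) :
    ∃ y, Represents ((FlatTangle.e i).comp T) y ∧
      pE i * x = (X : ℤ[X]) ^ loops (.e i) T • y := by
  obtain ⟨μ, σ, y, h, hy, rfl⟩ := h
  have hl := lo_ne_hi i
  have he := shape_e i
  rw [← mul_assoc, ← arc_lo_hi]
  by_cases h1 : μ (lo i) = hi i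
  · refine ⟨_, ⟨_, _, _, he.cap_comp_arc h hl h1, hy, rfl⟩, ?_⟩
    rw [he.loops_cap_arc h hl h1, hy.arc_mul_of_arc hl h1, pow_one, smul_mul_assoc]
  rw [he.loops_cap h h1, pow_zero]
  simp only [one_smul]
  by_cases ha : μ (lo i) = lo i
  · by_cases hb : μ (hi i) = hi i
    · exact ⟨_, ⟨_, _, _, he.cap_comp_free h hl ha hb, hy.cons _ _ hl ha hb, rfl⟩, rfl⟩
    · obtain ⟨z, hz, hz'⟩ := hy.arc_mul_of_mixed hl ha rfl (Ne.symm hb)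
      refine ⟨_, ⟨_, _, _, he.cap_comp_mixed h hl ha rfl (Ne.symm hb), hz, rfl⟩, ?_⟩
      rw [hz', map_mul, mul_assoc]
  · by_cases hb : μ (hi i) = hi i
    -- The mirror image of the mixed case, with the two ends of the cap exchanged.
    · have he' := he
      rw [adj, swap_comm] at he'
      obtain ⟨z, hz, hz'⟩ := hy.arc_mul_of_mixed hl.symm hb rfl (Ne.symm ha)
      refine ⟨_, ⟨_, _, _, he'.cap_comp_mixed h hl.symm hb rfl (Ne.symm ha), hz, rfl⟩, ?_⟩
      rw [← arc_symm hl, hz', map_mul, mul_assoc]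
    · have hd : lo i ≠ μ (hi i) := fun e => h1 (by rw [e, h.invol])
      obtain ⟨z, hz, hz'⟩ := hy.arc_mul_of_two_arcs hl rfl rfl (Ne.symm ha) (Ne.symm hb) hd
      refine ⟨_, ⟨_, _, _, he.cap_comp_two_arcs h hl rfl rfl (Ne.symm ha) (Ne.symm hb) hd, hz,
        rfl⟩, ?_⟩
      rw [hz', map_mul, mul_assoc]

end Represents

/-- The element of the presented algebra that represents a tangle. -/
def FlatTangle.word {n : ℕ} (T : FlatTangle n) : Presented n := (exists_represents T).choose

theorem FlatTangle.represents_word {n : ℕ} (T : FlatTangle n) : Represents T T.word :=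
  (exists_represents T).choose_spec

/-- The linear map that sends a tangle to the element of the presented algebra representing it. -/
def fromVTL (n : ℕ) : VTL n →ₗ[ℤ[X]] Presented n :=
  (VTL.basis n).constr ℤ[X] FlatTangle.word

theorem fromVTL_of {n : ℕ} (T : FlatTangle n) : fromVTL n (VTL.of T) = T.word := by
  rw [fromVTL, ← VTL.basis_apply, Module.Basis.constr_basis]

theorem fromVTL_of_mul_of {n : ℕ} (g : Gen n) (T : FlatTangle n) :
    fromVTL n (VTL.of g.tangle * VTL.of T) = gen g * T.word := by
  rw [VTL.of_mul_of, map_smul, fromVTL_of]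
  cases g with
  | E i =>
    obtain ⟨y, hy, he⟩ := T.represents_word.e_comp i
    exact (congrArg _ ((FlatTangle.represents_word _).unique hy)).trans he.symm
  | v i =>
    rw [show loops (Gen.v i).tangle T = 0 from loops_v i, pow_zero, one_smul]
    exact (FlatTangle.represents_word _).unique (T.represents_word.v_comp i)

theorem fromVTL_of_mul {n : ℕ} (g : Gen n) (x : VTL n) :
    fromVTL n (VTL.of g.tangle * x) = gen g * fromVTL n x := by
  refine VTL.induction (p := fun x => fromVTL n (VTL.of g.tangle * x) = gen g * fromVTL n x) x
    (by simp) (fun x y hx hy => by rw [mul_add, map_add, hx, hy, map_add, mul_add])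
    (fun a T => ?_)
  rw [mul_smul_comm, map_smul, fromVTL_of_mul_of, map_smul, fromVTL_of, mul_smul_comm]

/-- Linearity over the presented algebra, which acts on tangles through `toVTL`; it suffices to know
it for generators. Taking `y = 1` gives the left inverse. -/
theorem fromVTL_toVTL_mul {n : ℕ} (x : Presented n) (y : VTL n) :
    fromVTL n (toVTL n x * y) = x * fromVTL n y := by
  obtain ⟨x, rfl⟩ := RingQuot.mkAlgHom_surjective ℤ[X] (Rel n) x
  induction x using FreeAlgebra.induction generalizing y with
  | grade0 r =>
    rw [AlgHom.commutes, AlgHom.commutes, ← Algebra.smul_def, map_smul, ← Algebra.smul_def]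
  | grade1 g => rw [← Presented.gen, toVTL_gen, fromVTL_of_mul]
  | mul a b ha hb => rw [map_mul (RingQuot.mkAlgHom _ _), map_mul (toVTL n), mul_assoc, ha, hb, mul_assoc]
  | add a b ha hb => rw [map_add, map_add, add_mul, map_add, ha, hb, add_mul]

theorem fromVTL_toVTL {n : ℕ} (x : Presented n) : fromVTL n (toVTL n x) = x := by
  have h := fromVTL_toVTL_mul x 1
  have h1 : fromVTL n 1 = 1 :=
    (fromVTL_of (.id n)).trans ((FlatTangle.represents_word _).unique represents_id)
  rwa [mul_one, h1, mul_one] at h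

/-! ### The tangles of the generators generate -/

/-- Left multiplication by the `v_i` along a word for `τ` acts on shapes in this way and stays in
the range. -/
theorem exists_shape_conj_mem_range {n : ℕ} (τ : Perm (Fin n)) : ∀ {T : FlatTangle n}
    {μ σ : Perm (Fin n)}, Shape T μ σ → VTL.of T ∈ (toVTL n).range →
      ∃ T', Shape T' (τ * μ * τ⁻¹) (τ * σ) ∧ VTL.of T' ∈ (toVTL n).range := by
  induction τ using adj_induction with
  | one =>
    intro T μ σ h hT
    exact ⟨T, by simpa using h, hT⟩
  | mul ρ i ih =>
    intro T μ σ h hT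
    obtain ⟨T', h1, h2⟩ := ih (h.v_comp i) (by
      rw [← of_v_mul_of]
      exact mul_mem ⟨_, toVTL_gen (.v i)⟩ hT)
    refine ⟨T', ?_, h2⟩
    rw [mul_inv_rev, adj_inv]
    simpa only [mul_assoc] using h1

theorem ArcProd.exists_shape_mem_range {n : ℕ} {μ : Perm (Fin n)} {x : Presented n}
    (h : ArcProd μ x) (σ : Perm (Fin n)) :
    ∃ T, Shape T μ σ ∧ VTL.of T ∈ (toVTL n).range := by
  induction h generalizing σ with
  | one => simpa using exists_shape_conj_mem_range σ (shape_id n) (one_mem _)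
  | @cons μ x a b hab ha hb h ih =>
    obtain ⟨T, hT, hm⟩ := ih σ
    obtain ⟨i, τ, -, rfl, rfl⟩ := exists_arc_eq hab
    -- The points `a`, `b` are moved to a neighbouring pair, where `E_i` adds the arc, and are then
    -- moved back by `τ`.
    obtain ⟨T', hT', hm'⟩ := exists_shape_conj_mem_range τ⁻¹ hT hm
    have h1 : (τ⁻¹ * μ * τ⁻¹⁻¹) (lo i) = lo i := by simp [ha]
    have h2 : (τ⁻¹ * μ * τ⁻¹⁻¹) (hi i) = hi i := by simp [hb]
    obtain ⟨T'', hT'', hm''⟩ := exists_shape_conj_mem_range τ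
      ((shape_e i).cap_comp_free hT' (lo_ne_hi i) h1 h2) (by
        rw [← hT'.of_e_mul_of (by rw [h1]; exact lo_ne_hi i)]
        exact mul_mem ⟨_, toVTL_gen (.E i)⟩ hm')
    refine ⟨T'', ?_, hm''⟩
    rw [swap_conj]
    convert hT'' using 1 <;> group

theorem toVTL_surjective (n : ℕ) : Function.Surjective (toVTL n) := by
  intro x
  change x ∈ (toVTL n).range
  refine VTL.induction (p := fun x => x ∈ (toVTL n).range) x (zero_mem _)
    (fun _ _ => add_mem) (fun a T => Subalgebra.smul_mem _ ?_ a)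
  obtain ⟨μ, σ, h⟩ := T.exists_shape
  obtain ⟨y, hy⟩ := exists_arcProd μ h.invol
  obtain ⟨T', h', hm⟩ := hy.exists_shape_mem_range σ
  rwa [h.ext h']

theorem toVTL_injective (n : ℕ) : Function.Injective (toVTL n) :=
  Function.LeftInverse.injective fromVTL_toVTL

end VirtualTL

end

theorem proposition2p2 (n : ℕ) (hn : 2 ≤ n) :
    ∃ φ : VirtualTL.Presented n ≃ₐ[Polynomial ℤ] VirtualTL.VTL n,
      (∀ i : Fin (n - 1), φ (VirtualTL.Presented.gen (VirtualTL.Gen.E i)) =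
        VirtualTL.VTL.of (VirtualTL.FlatTangle.e i)) ∧
      (∀ i : Fin (n - 1), φ (VirtualTL.Presented.gen (VirtualTL.Gen.v i)) =
        VirtualTL.VTL.of (VirtualTL.FlatTangle.v i)) := by
  exact ⟨AlgEquiv.ofBijective (VirtualTL.toVTL n)
    ⟨VirtualTL.toVTL_injective n, VirtualTL.toVTL_surjective n⟩,
    fun i => VirtualTL.toVTL_gen (.E i), fun i => VirtualTL.toVTL_gen (.v i)⟩
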